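/- Conventions. $2$-categories and $2$-functors are strict; all $2$-categories are locally small, so that homs are small categories. A lax natural transformation $\alpha\colon G\Rightarrow H$ has structure $2$-cells $\alpha_f\colon H(f)\circ\alpha_X\Rightarrow\alpha_Y\circ G(f)$ for $f\colon X\to Y$; for an oplax one the $2$-cells point the other way, $\alpha_Y\circ G(f)\Rightarrow H(f)\circ\alpha_X$. $\mathrm{Lax}[\mathcal A,\mathcal C]$ is the $2$-category of $2$-functors $\mathcal A\to\mathcal C$, lax natural transformations and modifications. A split discrete $2$-opfibration is a $2$-functor $K\colon\mathcal B\to\mathcal A$ whose underlying functor is a split Grothendieck opfibration (with chosen opcartesian lifts that are strictly compatible with identities and composition) and such that every functor $K_{B,B'}\colon\mathcal B(B,B')\to\mathcal A(KB,KB')$ is a discrete fibration. A lax natural transformation between $2$-functors on $\mathcal B$, or an oplax natural transformation between $2$-functors $\mathcal B^{\mathrm{op}}\to\mathbf{Cat}$, is called cartesian-marked if its structure $2$-cells on all chosen opcartesian lifts are identities. (If $K$ is the projection $\int M\to\mathcal A$ of the $2$-category of elements of a $2$-functor $M\colon\mathcal A\to\mathbf{Cat}$, the chosen lifts are the morphisms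 $(f,\mathrm{id})\colon(A,X)\to(A',M(f)(X))$.) Write $[\mathcal B^{\mathrm{op}},\mathbf{Cat}]_{\mathrm{oplax}^{\mathrm{cart}}}(V,W)$ for the category of cartesian-marked oplax natural transformations $V\Rightarrow W$ and modifications. Proposition. Let $\mathcal B$ be a small $2$-category, let $K\colon\mathcal B\to\mathcal A$ be a split discrete $2$-opfibration, let $F\colon\mathcal B\to\mathcal C$ and $L\colon\mathcal A\to\mathcal C$ be $2$-functors, and let $\lambda\colon F\Rightarrow L\circ K$ be a lax natural transformation. Assume that $\lambda$ exhibits $L$ as the pointwise left Kan extension of $F$ along $K$, that is: $\lambda$ is cartesian-marked, and for all $A\in\mathcal A$ and $C\in\mathcal C$ the functor $$\mathcal C(L(A),C)\longrightarrow[\mathcal B^{\mathrm{op}},\mathbf{Cat}]_{\mathrm{oplax}^{\mathrm{cart}}}\bigl(\mathcal A(K(-),A),\,\mathcal C(F(-),C)\bigr)$$ obtained by composing with the cartesian-marked oplax natural transformation $$\mathcal A(K(-),A)\xrightarrow{\;L\;}\mathcal C(LK(-),L(A))\xrightarrow{\;\mathcal C(\lambda_{-},\mathrm{id})\;}\mathcal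 C(F(-),L(A))$$ is an isomorphism of categories. Then $\lambda$ exhibits $L$ as the weak left Kan extension of $F$ along $K$, that is: for every $2$-functor $U\colon\mathcal A\to\mathcal C$, pasting with $\lambda$, i.e. $\varphi\mapsto(\varphi K)\circ\lambda$, is an isomorphism of categories $$\mathrm{Lax}[\mathcal A,\mathcal C](L,U)\;\cong\;\mathrm{Lax}[\mathcal B,\mathcal C](F,U\circ K).$$ -/

import Mathlib

open CategoryTheory Bicategory Opposite Bicategory.Opposite

universe w v u w₁ v₁ u₁ u₂ u₃

namespace TwoCat

set_option linter.unusedSectionVars false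

section
variable {B : Type u₁} [Bicategory.{w₁, v₁} B]

theorem op2_eqToHom {a b : B} {f g : a ⟶ b} (h : f = g) :
    op2 (eqToHom h) = eqToHom (congrArg Quiver.Hom.op h) := by
  cases h
  rfl

/-- The 1-cell dual of a 2-category is a 2-category. -/
instance strictOp [Strict B] : Strict Bᵒᵖ where
  id_comp f := Quiver.Hom.unop_inj (Strict.comp_id f.unop)
  comp_id f := Quiver.Hom.unop_inj (Strict.id_comp f.unop)
  assoc f g h := Quiver.Hom.unop_inj (Strict.assoc h.unop g.unop f.unop).symm
  leftUnitor_eqToIso f := by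
    ext
    change op2 (ρ_ f.unop).hom = _
    rw [Strict.rightUnitor_eqToIso, eqToIso.hom, op2_eqToHom]
    rfl
  rightUnitor_eqToIso f := by
    ext
    change op2 (λ_ f.unop).hom = _
    rw [Strict.leftUnitor_eqToIso, eqToIso.hom, op2_eqToHom]
    rfl
  associator_eqToIso f g h := by
    ext
    change op2 (α_ h.unop g.unop f.unop).inv = _
    rw [Strict.associator_eqToIso, eqToIso.inv, op2_eqToHom]
    rfl
end

section
variable {B : Type u₁} [Bicategory.{w₁, v₁} B] [Strict B]
  {C : Type u} [Bicategory.{w, v} C] [Strict C]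

theorem id_whiskerLeft_strict {a X : C} {u v : a ⟶ X} (η : u ⟶ v) :
    𝟙 a ◁ η = eqToHom (Strict.id_comp u) ≫ η ≫ eqToHom (Strict.id_comp v).symm := by
  simp [Strict.leftUnitor_eqToIso]

theorem comp_whiskerLeft_strict {a b c X : C} (f : a ⟶ b) (g : b ⟶ c) {u v : c ⟶ X} (η : u ⟶ v) :
    (f ≫ g) ◁ η =
      eqToHom (Strict.assoc f g u) ≫ f ◁ g ◁ η ≫ eqToHom (Strict.assoc f g v).symm := by
  simp [Strict.associator_eqToIso]

theorem whiskerRight_comp_strict {a b c X : C} {f f' : a ⟶ b} (η : f ⟶ f') (g : b ⟶ c)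
    (u : c ⟶ X) :
    η ▷ (g ≫ u) =
      eqToHom (Strict.assoc f g u).symm ≫ (η ▷ g) ▷ u ≫ eqToHom (Strict.assoc f' g u) := by
  simp [Strict.associator_eqToIso]

theorem whisker_assoc_strict {a b c X : C} (k : a ⟶ b) {f f' : b ⟶ c} (η : f ⟶ f') (u : c ⟶ X) :
    (k ◁ η) ▷ u =
      eqToHom (Strict.assoc k f u) ≫ k ◁ (η ▷ u) ≫ eqToHom (Strict.assoc k f' u).symm := by
  simp [Strict.associator_eqToIso]

theorem precomp_id (a X : C) : (precomp X (𝟙 a)).toCatHom = 𝟙 (Cat.of (a ⟶ X)) := by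
  ext1
  exact CategoryTheory.Functor.ext (fun u => Strict.id_comp u)
    (fun _ _ η => id_whiskerLeft_strict η)

theorem precomp_comp {a b c : C} (f : a ⟶ b) (g : b ⟶ c) (X : C) :
    (precomp X (f ≫ g)).toCatHom = (precomp X g).toCatHom ≫ (precomp X f).toCatHom := by
  ext1
  exact CategoryTheory.Functor.ext (fun u => Strict.assoc f g u)
    (fun _ _ η => comp_whiskerLeft_strict f g η)

theorem homInto_aux_left (G : StrictPseudofunctor B C) {a b c : B} {X : C} {f f' : a ⟶ b}
    (η : f ⟶ f') (g : b ⟶ c) (u : G.obj c ⟶ X)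
    (h₁ : G.map (f ≫ g) ≫ u = G.map f ≫ G.map g ≫ u)
    (h₂ : G.map f' ≫ G.map g ≫ u = G.map (f' ≫ g) ≫ u) :
    G.map₂ (η ▷ g) ▷ u = eqToHom h₁ ≫ G.map₂ η ▷ (G.map g ≫ u) ≫ eqToHom h₂ := by
  rw [G.map₂_whisker_right, G.mapComp_eq_eqToIso, G.mapComp_eq_eqToIso, whiskerRight_comp_strict]
  simp [-whiskerRight_comp]

theorem homInto_aux_right (G : StrictPseudofunctor B C) {a b c : B} {X : C} (f : a ⟶ b)
    {g g' : b ⟶ c} (η : g ⟶ g') (u : G.obj c ⟶ X)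
    (h₁ : G.map (f ≫ g) ≫ u = G.map f ≫ G.map g ≫ u)
    (h₂ : G.map f ≫ G.map g' ≫ u = G.map (f ≫ g') ≫ u) :
    G.map₂ (f ◁ η) ▷ u = eqToHom h₁ ≫ G.map f ◁ (G.map₂ η ▷ u) ≫ eqToHom h₂ := by
  rw [G.map₂_whisker_left, G.mapComp_eq_eqToIso, G.mapComp_eq_eqToIso]
  simp only [comp_whiskerRight, whisker_assoc_strict]
  simp [-whisker_assoc]

/-- The 2-functor `C(G(-), X) : Bᵒᵖ ⥤ Cat`. -/
def homInto (G : StrictPseudofunctor B C) (X : C) : StrictPseudofunctor Bᵒᵖ Cat.{w, v} :=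
  StrictPseudofunctor.mk''
    { obj := fun b => Cat.of (G.obj b.unop ⟶ X)
      map := fun f => (precomp X (G.map f.unop)).toCatHom
      map₂ := fun η => NatTrans.toCatHom₂ ((precomposing _ _ X).map (G.map₂ η.unop2))
      map₂_id := fun f => by
        ext u
        change G.map₂ (𝟙 f.unop) ▷ (show G.obj _ ⟶ X from u) = 𝟙 _
        rw [G.map₂_id, id_whiskerRight]
      map₂_comp := fun η θ => by
        ext u
        change G.map₂ (η.unop2 ≫ θ.unop2) ▷ (show G.obj _ ⟶ X from u) =
          G.map₂ η.unop2 ▷ (show G.obj _ ⟶ X from u) ≫ G.map₂ θ.unop2 ▷ (show G.obj _ ⟶ X from u)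
        rw [G.map₂_comp, comp_whiskerRight]
      map_id := fun b => by
        change (precomp X (G.map (𝟙 b.unop))).toCatHom = _
        rw [G.map_id, precomp_id]
      map_comp := fun f g => by
        change (precomp X (G.map (g.unop ≫ f.unop))).toCatHom = _
        rw [G.map_comp, precomp_comp]
      map₂_whisker_left := fun {a b c} f {g g'} η => by
        ext u
        rw [Cat.Hom₂.comp_app, Cat.Hom₂.comp_app, Cat.eqToHom_app, Cat.eqToHom_app]
        exact homInto_aux_left G η.unop2 f.unop u _ _
      map₂_whisker_right := fun {a b c} f f' η g => by
        ext u
        rw [Cat.Hom₂.comp_app, Cat.Hom₂.comp_app, Cat.eqToHom_app, Cat.eqToHom_app]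
        exact homInto_aux_right G g.unop η.unop2 u _ _ }

theorem map_id_comp (G : StrictPseudofunctor B C) {b : B} {X : C} (u : G.obj b ⟶ X) :
    G.map (𝟙 b) ≫ u = u := by
  rw [G.map_id, Strict.id_comp]

theorem map_comp_comp (G : StrictPseudofunctor B C) {a b c : B} {X : C} (f : a ⟶ b) (g : b ⟶ c)
    (u : G.obj c ⟶ X) : G.map (f ≫ g) ≫ u = G.map f ≫ G.map g ≫ u := by
  rw [G.map_comp, Strict.assoc]

theorem homInto_mapId_app (G : StrictPseudofunctor B C) (X : C) (b : B) (u : G.obj b ⟶ X) :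
    ((homInto G X).toLax.mapId (op b)).toNatTrans.app u =
      eqToHom (map_id_comp G u).symm := by
  exact Cat.eqToHom_app _ _ ((homInto G X).map_id (op b)).symm u

theorem homInto_mapComp_app (G : StrictPseudofunctor B C) (X : C) {a b c : B} (f : a ⟶ b)
    (g : b ⟶ c) (u : G.obj c ⟶ X) :
    ((homInto G X).toLax.mapComp g.op f.op).toNatTrans.app u =
      eqToHom (map_comp_comp G f g u).symm := by
  exact Cat.eqToHom_app _ _ ((homInto G X).map_comp g.op f.op).symm u

/-- Constructor for oplax natural transformations `A(G(-), X) ⇒ C(G'(-), Y)`: functors on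
hom-categories, structure 2-cells `nat`, and the compatibilities with 2-cells, identities and
composition. -/
def mkOplax {A : Type u₂} [Bicategory.{w, v} A] [Strict A] {G : StrictPseudofunctor B A} {G' : StrictPseudofunctor B C} {X : A} {Y : C}
    (app : ∀ b : B, (G.obj b ⟶ X) ⥤ (G'.obj b ⟶ Y))
    (nat : ∀ {b b' : B} (f : b ⟶ b'), precomp X (G.map f) ⋙ app b ⟶ app b' ⋙ precomp Y (G'.map f))
    (nat₂ : ∀ {b b' : B} {f g : b ⟶ b'} (η : f ⟶ g) (u : G.obj b' ⟶ X),
      (app b).map (G.map₂ η ▷ u) ≫ (nat g).app u = (nat f).app u ≫ G'.map₂ η ▷ (app b').obj u)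
    (nat_id : ∀ (b : B) (u : G.obj b ⟶ X) (h), (nat (𝟙 b)).app u = eqToHom h)
    (nat_comp : ∀ {a b c : B} (f : a ⟶ b) (g : b ⟶ c) (u : G.obj c ⟶ X) (h₁ h₂),
      (nat (f ≫ g)).app u = eqToHom h₁ ≫ (nat f).app (G.map g ≫ u) ≫
        G'.map f ◁ (nat g).app u ≫ eqToHom h₂) :
    Lax.OplaxTrans (homInto G X).toLax (homInto G' Y).toLax where
  app b := (app b.unop).toCatHom
  naturality f := (nat f.unop).toCatHom₂
  naturality_naturality η := by
    ext u
    exact nat₂ η.unop2 u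
  naturality_id b := by
    ext u
    have e₁ := homInto_mapId_app G X b.unop u
    have e₂ := homInto_mapId_app G' Y b.unop ((app b.unop).obj u)
    change (app b.unop).map (((homInto G X).toLax.mapId b).toNatTrans.app u) ≫
      (nat (𝟙 b.unop)).app u = 𝟙 _ ≫ 𝟙 _ ≫
        ((homInto G' Y).toLax.mapId b).toNatTrans.app ((app b.unop).obj u)
    refine (congrArg₂ (· ≫ ·) ((congrArg (app b.unop).map e₁).trans (eqToHom_map _ _))
      (nat_id b.unop u ?_)).trans (Eq.trans ?_ ((Category.id_comp _).trans
        ((Category.id_comp _).trans e₂)).symm)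
    · change (app b.unop).obj (G.map (𝟙 b.unop) ≫ u) = G'.map (𝟙 b.unop) ≫ (app b.unop).obj u
      exact (congrArg (app b.unop).obj (map_id_comp G u)).trans (map_id_comp G' _).symm
    · exact eqToHom_trans _ _
  naturality_comp {a b c} f g := by
    ext u
    have e₁ := homInto_mapComp_app G X g.unop f.unop u
    have e₂ := homInto_mapComp_app G' Y g.unop f.unop ((app a.unop).obj u)
    have h₁ : (app c.unop).obj (G.map (g.unop ≫ f.unop) ≫ u) =
        (app c.unop).obj (G.map g.unop ≫ G.map f.unop ≫ u) :=
      congrArg (app c.unop).obj (map_comp_comp G g.unop f.unop u)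
    have h₂ : G'.map g.unop ≫ G'.map f.unop ≫ (app a.unop).obj u =
        G'.map (g.unop ≫ f.unop) ≫ (app a.unop).obj u :=
      (map_comp_comp G' g.unop f.unop _).symm
    have e₃ := nat_comp g.unop f.unop u h₁ h₂
    change (app c.unop).map (((homInto G X).toLax.mapComp f g).toNatTrans.app u) ≫
      (nat (g.unop ≫ f.unop)).app u = 𝟙 _ ≫ (nat g.unop).app (G.map f.unop ≫ u) ≫ 𝟙 _ ≫
        G'.map g.unop ◁ (nat f.unop).app u ≫ 𝟙 _ ≫
        ((homInto G' Y).toLax.mapComp f g).toNatTrans.app ((app a.unop).obj u)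
    refine (congrArg₂ (· ≫ ·) ((congrArg (app c.unop).map e₁).trans (eqToHom_map _ _))
      e₃).trans ?_
    refine Eq.trans (eqToHom_trans_assoc _ _ _) ?_
    refine (Category.id_comp _).trans ?_
    refine Eq.trans ?_ (Category.id_comp _).symm
    refine congrArg _ ?_
    refine Eq.trans ?_ (Category.id_comp _).symm
    refine congrArg _ ?_
    exact e₂.symm.trans (Category.id_comp _).symm

theorem lax_id_aux {p q : C} {x : p ⟶ q} {y : q ⟶ q} {y' : p ⟶ p} (hy : y = 𝟙 q) (hy' : y' = 𝟙 p)
    {i : 𝟙 q ⟶ y} {i' : 𝟙 p ⟶ y'} (hi : i = eqToHom hy.symm) (hi' : i' = eqToHom hy'.symm)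
    {n : x ≫ y ⟶ y' ≫ x} (e : x ◁ i ≫ n = (ρ_ x).hom ≫ (λ_ x).inv ≫ i' ▷ x)
    (h : x ≫ y = y' ≫ x) : n = eqToHom h := by
  subst hy hy' hi hi'
  simpa [Strict.leftUnitor_eqToIso, Strict.rightUnitor_eqToIso] using e

theorem lax_comp_aux {a b c a' b' c' : C} {xa : a ⟶ a'} {xb : b ⟶ b'} {xc : c ⟶ c'}
    {gf : a' ⟶ b'} {gk : b' ⟶ c'} {g : a' ⟶ c'} {ff : a ⟶ b} {fk : b ⟶ c} {f : a ⟶ c}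
    (hg : g = gf ≫ gk) (hf : f = ff ≫ fk) {i : gf ≫ gk ⟶ g} {i' : ff ≫ fk ⟶ f}
    (hi : i = eqToHom hg.symm) (hi' : i' = eqToHom hf.symm)
    {m : xa ≫ gf ⟶ ff ≫ xb} {n : xb ≫ gk ⟶ fk ≫ xc} {r : xa ≫ g ⟶ f ≫ xc}
    (e : xa ◁ i ≫ r = (α_ _ _ _).inv ≫ m ▷ gk ≫ (α_ _ _ _).hom ≫ ff ◁ n ≫
      (α_ _ _ _).inv ≫ i' ▷ xc)
    (h₁ : xa ≫ g = (xa ≫ gf) ≫ gk) (h₂ : ff ≫ fk ≫ xc = f ≫ xc) :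
    r = eqToHom h₁ ≫ m ▷ gk ≫ eqToHom (Strict.assoc _ _ _) ≫ ff ◁ n ≫ eqToHom h₂ := by
  subst hg hf hi hi'
  simpa [Strict.associator_eqToIso] using e

theorem lax_id_aux' {p q : C} {x : p ⟶ q} {y : q ⟶ q} {y' : p ⟶ p} (hy : y = 𝟙 q)
    (hy' : y' = 𝟙 p) {i : 𝟙 q ⟶ y} {i' : 𝟙 p ⟶ y'} (hi : i = eqToHom hy.symm)
    (hi' : i' = eqToHom hy'.symm) {n : x ≫ y ⟶ y' ≫ x} (e : ∀ h, n = eqToHom h) :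
    x ◁ i ≫ n = (ρ_ x).hom ≫ (λ_ x).inv ≫ i' ▷ x := by
  subst hy hy' hi hi'
  rw [e ((Strict.comp_id x).trans (Strict.id_comp x).symm)]
  simp [Strict.leftUnitor_eqToIso, Strict.rightUnitor_eqToIso]

theorem lax_comp_aux' {a b c a' b' c' : C} {xa : a ⟶ a'} {xb : b ⟶ b'} {xc : c ⟶ c'}
    {gf : a' ⟶ b'} {gk : b' ⟶ c'} {g : a' ⟶ c'} {ff : a ⟶ b} {fk : b ⟶ c} {f : a ⟶ c}
    (hg : g = gf ≫ gk) (hf : f = ff ≫ fk) {i : gf ≫ gk ⟶ g} {i' : ff ≫ fk ⟶ f}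
    (hi : i = eqToHom hg.symm) (hi' : i' = eqToHom hf.symm)
    {m : xa ≫ gf ⟶ ff ≫ xb} {n : xb ≫ gk ⟶ fk ≫ xc} {r : xa ≫ g ⟶ f ≫ xc}
    (e : ∀ h₁ h₂, r = eqToHom h₁ ≫ m ▷ gk ≫ eqToHom (Strict.assoc _ _ _) ≫ ff ◁ n ≫ eqToHom h₂) :
    xa ◁ i ≫ r = (α_ _ _ _).inv ≫ m ▷ gk ≫ (α_ _ _ _).hom ≫ ff ◁ n ≫
      (α_ _ _ _).inv ≫ i' ▷ xc := by
  subst hg hf hi hi'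
  rw [e (Strict.assoc _ _ _).symm (Strict.assoc _ _ _).symm]
  simp [Strict.associator_eqToIso]

theorem toLax_mapId (F : StrictPseudofunctor B C) (b : B) :
    F.toLax.mapId b = eqToHom (F.map_id b).symm := by
  change (F.mapId b).inv = _
  rw [F.mapId_eq_eqToIso]
  rfl

theorem toLax_mapComp (F : StrictPseudofunctor B C) {a b c : B} (f : a ⟶ b) (g : b ⟶ c) :
    F.toLax.mapComp f g = eqToHom (F.map_comp f g).symm := by
  change (F.mapComp f g).inv = _
  rw [F.mapComp_eq_eqToIso]
  rfl

theorem postcomp_naturality_aux {C : Type u} [Bicategory.{w, v} C] {p q X Y : C} (x : p ⟶ q)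
    (u : q ⟶ X) {g g' : X ⟶ Y} (γ : g ⟶ g') :
    (x ≫ u) ◁ γ ≫ (α_ x u g').hom = (α_ x u g).hom ≫ x ◁ u ◁ γ := by
  simp

theorem laxTrans_naturality_id {F G : StrictPseudofunctor B C}
    (l : Lax.LaxTrans F.toLax G.toLax) (b : B)
    (h : l.app b ≫ G.map (𝟙 b) = F.map (𝟙 b) ≫ l.app b) :
    l.naturality (𝟙 b) = eqToHom h :=
  lax_id_aux (G.map_id b) (F.map_id b) (toLax_mapId G b) (toLax_mapId F b)
    (l.naturality_id b) h

theorem laxTrans_naturality_comp {F G : StrictPseudofunctor B C}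
    (l : Lax.LaxTrans F.toLax G.toLax) {a b c : B} (f : a ⟶ b) (g : b ⟶ c)
    (h₁ : l.app a ≫ G.map (f ≫ g) = (l.app a ≫ G.map f) ≫ G.map g)
    (h₂ : F.map f ≫ F.map g ≫ l.app c = F.map (f ≫ g) ≫ l.app c) :
    l.naturality (f ≫ g) = eqToHom h₁ ≫ l.naturality f ▷ G.map g ≫
      eqToHom (Strict.assoc _ _ _) ≫ F.map f ◁ l.naturality g ≫ eqToHom h₂ :=
  lax_comp_aux (G.map_comp f g) (F.map_comp f g) (toLax_mapComp G f g) (toLax_mapComp F f g)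
    (l.naturality_comp f g) h₁ h₂

theorem laxTrans_naturality_of_eq_id {F G : StrictPseudofunctor B C}
    (l : Lax.LaxTrans F.toLax G.toLax) {b : B} {f : b ⟶ b} (hf : f = 𝟙 b)
    (h : l.app b ≫ G.map f = F.map f ≫ l.app b) : l.naturality f = eqToHom h := by
  subst hf
  exact laxTrans_naturality_id l b h

theorem laxTrans_naturality_of_eq_comp {F G : StrictPseudofunctor B C}
    (l : Lax.LaxTrans F.toLax G.toLax) {a b c : B} {f : a ⟶ b} {g : b ⟶ c} {k : a ⟶ c}
    (hk : k = f ≫ g) (h₁ : l.app a ≫ G.map k = (l.app a ≫ G.map f) ≫ G.map g)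
    (h₂ : F.map f ≫ F.map g ≫ l.app c = F.map k ≫ l.app c) :
    l.naturality k = eqToHom h₁ ≫ l.naturality f ▷ G.map g ≫
      eqToHom (Strict.assoc _ _ _) ≫ F.map f ◁ l.naturality g ≫ eqToHom h₂ := by
  subst hk
  exact laxTrans_naturality_comp l f g h₁ h₂

/-- Postcomposition with `g : X ⟶ Y` as a 2-natural transformation `C(G(-), X) ⇒ C(G(-), Y)`. -/
def homPostcomp (G : StrictPseudofunctor B C) {X Y : C} (g : X ⟶ Y) :
    Lax.OplaxTrans (homInto G X).toLax (homInto G Y).toLax :=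
  mkOplax (G := G) (G' := G) (fun b => postcomp (G.obj b) g)
    (fun f => { app := fun u => (α_ (G.map f) u g).hom
                naturality := fun u v η => by
                  change (G.map _ ◁ η) ▷ g ≫ (α_ _ _ _).hom = (α_ _ _ _).hom ≫ G.map _ ◁ η ▷ g
                  simp })
    (fun η u => by
      change (G.map₂ η ▷ u) ▷ g ≫ (α_ _ _ _).hom = (α_ _ _ _).hom ≫ G.map₂ η ▷ (u ≫ g)
      simp)
    (fun b u h => by
      change (α_ (G.map (𝟙 b)) u g).hom = _
      rw [Strict.associator_eqToIso]
      rfl)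
    (fun f k u (h₁ : (G.map (f ≫ k) ≫ u) ≫ g = (G.map f ≫ G.map k ≫ u) ≫ g)
        (h₂ : G.map f ≫ G.map k ≫ u ≫ g = G.map (f ≫ k) ≫ u ≫ g) => by
      change (α_ (G.map (f ≫ k)) u g).hom =
        eqToHom h₁ ≫ (α_ (G.map f) (G.map k ≫ u) g).hom ≫ G.map f ◁ (α_ (G.map k) u g).hom ≫
          eqToHom h₂
      simp [Strict.associator_eqToIso])

theorem homPrecomp_naturality {C : Type u} [Bicategory.{w, v} C] {p q r s X : C} (x : p ⟶ q) (y : q ⟶ r) (x' : p ⟶ s) (y' : s ⟶ r)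
    (n : x ≫ y ⟶ x' ≫ y') {u v : r ⟶ X} (η : u ⟶ v) :
    x ◁ y ◁ η ≫ (α_ x y v).inv ≫ n ▷ v ≫ (α_ x' y' v).hom =
      ((α_ x y u).inv ≫ n ▷ u ≫ (α_ x' y' u).hom) ≫ x' ◁ y' ◁ η := by
  rw [associator_inv_naturality_right_assoc, whisker_exchange_assoc, Category.assoc,
    Category.assoc, associator_naturality_right]

theorem homPrecomp_naturality₂ {p q r s X : C} {x : p ⟶ q} {y₁ y₂ : q ⟶ r} {x₁ x₂ : p ⟶ s}
    {y' : s ⟶ r} (n₁ : x ≫ y₁ ⟶ x₁ ≫ y') (n₂ : x ≫ y₂ ⟶ x₂ ≫ y') (η : x₁ ⟶ x₂) (θ : y₁ ⟶ y₂)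
    (h : n₁ ≫ η ▷ y' = x ◁ θ ≫ n₂) (u : r ⟶ X) :
    x ◁ θ ▷ u ≫ (α_ x y₂ u).inv ≫ n₂ ▷ u ≫ (α_ x₂ y' u).hom =
      ((α_ x y₁ u).inv ≫ n₁ ▷ u ≫ (α_ x₁ y' u).hom) ≫ η ▷ (y' ≫ u) := by
  rw [associator_inv_naturality_middle_assoc, ← comp_whiskerRight_assoc, ← h]
  simp

theorem homPrecomp_id {p q X : C} (x : p ⟶ q) (y : q ⟶ q) (y' : p ⟶ p) (h₁ : x ≫ y = y' ≫ x)
    (u : q ⟶ X) (h : x ≫ y ≫ u = y' ≫ x ≫ u) :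
    (α_ x y u).inv ≫ eqToHom h₁ ▷ u ≫ (α_ y' x u).hom = eqToHom h := by
  simp [Strict.associator_eqToIso]

theorem homPrecomp_comp {a b c a' b' c' X : C} {xa : a ⟶ a'} {xb : b ⟶ b'} {xc : c ⟶ c'}
    {gf : a' ⟶ b'} {gk : b' ⟶ c'} {g : a' ⟶ c'} {ff : a ⟶ b} {fk : b ⟶ c} {f : a ⟶ c}
    (hg : g = gf ≫ gk) (hf : f = ff ≫ fk) (m : xa ≫ gf ⟶ ff ≫ xb) (n : xb ≫ gk ⟶ fk ≫ xc)
    (u : c' ⟶ X) (e₁ : xa ≫ g = (xa ≫ gf) ≫ gk) (e₂ : ff ≫ fk ≫ xc = f ≫ xc)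
    (h₁ : xa ≫ g ≫ u = xa ≫ gf ≫ gk ≫ u) (h₂ : ff ≫ fk ≫ xc ≫ u = f ≫ xc ≫ u) :
    (α_ xa g u).inv ≫ (eqToHom e₁ ≫ m ▷ gk ≫ eqToHom (Strict.assoc _ _ _) ≫ ff ◁ n ≫
        eqToHom e₂) ▷ u ≫ (α_ f xc u).hom =
      eqToHom h₁ ≫ ((α_ xa gf (gk ≫ u)).inv ≫ m ▷ (gk ≫ u) ≫ (α_ ff xb (gk ≫ u)).hom) ≫
        ff ◁ ((α_ xb gk u).inv ≫ n ▷ u ≫ (α_ fk xc u).hom) ≫ eqToHom h₂ := by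
  subst hg hf
  simp only [whiskerRight_comp_strict, comp_whiskerRight, whisker_assoc_strict,
    Bicategory.whiskerLeft_comp]
  simp [Strict.associator_eqToIso, -whiskerRight_comp, -whisker_assoc]

/-- Precomposition with the components of a lax natural transformation `l : F ⇒ G`, as an oplax
natural transformation `C(l, id) : C(G(-), X) ⇒ C(F(-), X)`. -/
def homPrecomp {F G : StrictPseudofunctor B C} (l : Lax.LaxTrans F.toLax G.toLax) (X : C) :
    Lax.OplaxTrans (homInto G X).toLax (homInto F X).toLax :=
  mkOplax (G := G) (G' := F) (fun b => precomp X (l.app b))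
    (fun {b b'} f =>
      { app := fun u => (α_ (l.app b) (G.map f) u).inv ≫ l.naturality f ▷ u ≫
          (α_ (F.map f) (l.app b') u).hom
        naturality := fun u v η => by
          change l.app b ◁ G.map f ◁ η ≫ (α_ (l.app b) (G.map f) v).inv ≫ l.naturality f ▷ v ≫
              (α_ (F.map f) (l.app b') v).hom =
            ((α_ (l.app b) (G.map f) u).inv ≫ l.naturality f ▷ u ≫
              (α_ (F.map f) (l.app b') u).hom) ≫ F.map f ◁ l.app b' ◁ η
          exact homPrecomp_naturality (l.app b) (G.map f) (F.map f) (l.app b') (l.naturality f) η })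
    (fun {b b' f g} η u => homPrecomp_naturality₂ (l.naturality f) (l.naturality g)
      (F.map₂ η) (G.map₂ η) (l.naturality_naturality η) u)
    (fun b u (h : l.app b ≫ G.map (𝟙 b) ≫ u = F.map (𝟙 b) ≫ l.app b ≫ u) => by
      have h₁ : l.app b ≫ G.map (𝟙 b) = F.map (𝟙 b) ≫ l.app b := by
        rw [F.map_id, G.map_id]
        exact (Strict.comp_id _).trans (Strict.id_comp _).symm
      change (α_ (l.app b) (G.map (𝟙 b)) u).inv ≫ l.naturality (𝟙 b) ▷ u ≫
          (α_ (F.map (𝟙 b)) (l.app b) u).hom = eqToHom h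
      rw [laxTrans_naturality_id l b h₁]
      exact homPrecomp_id (l.app b) (G.map (𝟙 b)) (F.map (𝟙 b)) h₁ u h)
    (fun {a b c} f k u (h₁ : l.app a ≫ G.map (f ≫ k) ≫ u = l.app a ≫ G.map f ≫ G.map k ≫ u)
        (h₂ : F.map f ≫ F.map k ≫ l.app c ≫ u = F.map (f ≫ k) ≫ l.app c ≫ u) => by
      have e₁ : l.app a ≫ G.map (f ≫ k) = (l.app a ≫ G.map f) ≫ G.map k := by
        rw [G.map_comp]
        exact (Strict.assoc _ _ _).symm
      have e₂ : F.map f ≫ F.map k ≫ l.app c = F.map (f ≫ k) ≫ l.app c := by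
        rw [F.map_comp]
        exact (Strict.assoc _ _ _).symm
      change (α_ (l.app a) (G.map (f ≫ k)) u).inv ≫ l.naturality (f ≫ k) ▷ u ≫
          (α_ (F.map (f ≫ k)) (l.app c) u).hom =
        eqToHom h₁ ≫ ((α_ (l.app a) (G.map f) (G.map k ≫ u)).inv ≫
          l.naturality f ▷ (G.map k ≫ u) ≫ (α_ (F.map f) (l.app b) (G.map k ≫ u)).hom) ≫
          F.map f ◁ ((α_ (l.app b) (G.map k) u).inv ≫ l.naturality k ▷ u ≫
            (α_ (F.map k) (l.app c) u).hom) ≫ eqToHom h₂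
      rw [laxTrans_naturality_comp l f k e₁ e₂]
      exact homPrecomp_comp (G.map_comp f k) (F.map_comp f k) (l.naturality f) (l.naturality k)
        u e₁ e₂ h₁ h₂)

variable {A : Type u₂} [Bicategory.{w, v} A] [Strict A]

theorem homMap_naturality (L : StrictPseudofunctor A C) {p q a : A} (f : p ⟶ q) {u v : q ⟶ a}
    (η : u ⟶ v) : L.map₂ (f ◁ η) ≫ (L.mapComp f v).hom =
      (L.mapComp f u).hom ≫ L.map f ◁ L.map₂ η := by
  simp

theorem homMap_naturality₂ (L : StrictPseudofunctor A C) {p q a : A} {f g : p ⟶ q} (η : f ⟶ g)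
    (u : q ⟶ a) : L.map₂ (η ▷ u) ≫ (L.mapComp g u).hom =
      (L.mapComp f u).hom ≫ L.map₂ η ▷ L.map u := by
  simp

theorem homMap_comp (L : StrictPseudofunctor A C) {p q r a : A} {f : p ⟶ q} {k : q ⟶ r}
    {g : p ⟶ r} (hg : g = f ≫ k) (u : r ⟶ a) (h₁ : L.map (g ≫ u) = L.map (f ≫ k ≫ u))
    (h₂ : L.map f ≫ L.map k ≫ L.map u = L.map g ≫ L.map u) :
    (L.mapComp g u).hom = eqToHom h₁ ≫ (L.mapComp f (k ≫ u)).hom ≫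
      L.map f ◁ (L.mapComp k u).hom ≫ eqToHom h₂ := by
  subst hg
  simp [L.mapComp_eq_eqToIso]

/-- The action of `L` on hom-categories, as a 2-natural transformation
`A(K(-), a) ⇒ C((L ∘ K)(-), L a)`. -/
def homMap (K : StrictPseudofunctor B A) (L : StrictPseudofunctor A C) (a : A) :
    Lax.OplaxTrans (homInto K a).toLax (homInto (K.comp L) (L.obj a)).toLax :=
  mkOplax (G := K) (G' := K.comp L) (X := a) (Y := L.obj a)
    (fun b => L.mapFunctor (K.obj b) a)
    (fun {b b'} f =>
      { app := fun u => (L.mapComp (K.map f) u).hom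
        naturality := fun u v η => homMap_naturality L (K.map f) η })
    (fun η u => homMap_naturality₂ L (K.map₂ η) u)
    (fun b u h => by
      change (L.mapComp (K.map (𝟙 b)) u).hom = _
      rw [L.mapComp_eq_eqToIso]
      rfl)
    (fun f k u h₁ h₂ => homMap_comp L (K.map_comp f k) u h₁ h₂)
end

section
variable {E : Type u} [Category.{v} E] {D : Type u₁} [Category.{v₁} D]

/-- A functor is an isomorphism of categories. -/
def IsIsoOfCategories (G : E ⥤ D) : Prop :=
  ∃ H : D ⥤ E, G ⋙ H = 𝟭 E ∧ H ⋙ G = 𝟭 D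

/-- Discrete fibrations: every `f : d ⟶ p e` has a unique lift with codomain `e`. -/
def IsDiscreteFibration (p : E ⥤ D) : Prop :=
  ∀ (e : E) {d : D} (f : d ⟶ p.obj e), ∃! q : Σ e' : E, (e' ⟶ e), p.IsHomLift f q.2

/-- A split Grothendieck opfibration structure on `p`: a choice of opcartesian lifts which is
strictly compatible with identities and composition. In `lift_comp`, the morphism
`p.map (lift f).2` is `f`, up to the equality between the codomain of `f` and
`p.obj (lift f).1`. -/
structure SplitOpfibration (p : E ⥤ D) where
  lift : ∀ {e : E} {d : D} (_ : p.obj e ⟶ d), Σ e' : E, (e ⟶ e')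
  isStronglyCocartesian : ∀ {e : E} {d : D} (f : p.obj e ⟶ d),
    p.IsStronglyCocartesian f (lift f).2
  lift_id : ∀ e : E, lift (𝟙 (p.obj e)) = ⟨e, 𝟙 e⟩
  lift_comp : ∀ {e : E} {d d' : D} (f : p.obj e ⟶ d) (g : p.obj (lift f).1 ⟶ d'),
    lift (p.map (lift f).2 ≫ g) = ⟨(lift g).1, (lift f).2 ≫ (lift g).2⟩

/-- The chosen opcartesian morphisms of a split opfibration: those in the image of `lift`. -/
def SplitOpfibration.IsChosen {p : E ⥤ D} (S : SplitOpfibration p) {e e' : E} (f : e ⟶ e') :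
    Prop :=
  ∃ (d : D) (g : p.obj e ⟶ d), S.lift g = ⟨e', f⟩

end

section
variable {B : Type u₁} [Bicategory.{w₁, v₁} B] [Strict B]
  {A : Type u₂} [Bicategory.{w, v} A] [Strict A]
  {C : Type u} [Bicategory.{w, v} C] [Strict C]

/-- A split discrete 2-opfibration: a 2-functor whose underlying functor is a split Grothendieck
opfibration and which is a discrete fibration on hom-categories. For the projection
`∫ M ⥤ A` of the 2-category of elements of `M : A ⥤ Cat`, the chosen lifts are the morphisms
`(f, id) : (a, x) ⟶ (a', M f x)`. -/
structure SplitDiscreteTwoOpfibration (K : StrictPseudofunctor B A) where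
  split : SplitOpfibration K.toFunctor
  isDiscreteFibration : ∀ b b' : B, IsDiscreteFibration (K.mapFunctor b b')

/-- A 2-cell is an identity. -/
def IsIdentityCell {D : Type u₃} [Bicategory.{w₁, v₁} D] {x y : D} {f g : x ⟶ y} (η : f ⟶ g) :
    Prop :=
  ∃ h : f = g, η = eqToHom h

theorem IsIdentityCell.comp {D : Type u₃} [Bicategory.{w₁, v₁} D] {x y : D} {f g h : x ⟶ y}
    {η : f ⟶ g} {θ : g ⟶ h} (hη : IsIdentityCell η) (hθ : IsIdentityCell θ) :
    IsIdentityCell (η ≫ θ) := by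
  obtain ⟨rfl, rfl⟩ := hη
  simpa using hθ

theorem IsIdentityCell.whiskerLeft {D : Type u₃} [Bicategory.{w₁, v₁} D] {x y z : D} (k : x ⟶ y)
    {f g : y ⟶ z} {η : f ⟶ g} (hη : IsIdentityCell η) : IsIdentityCell (k ◁ η) := by
  obtain ⟨rfl, rfl⟩ := hη
  exact ⟨rfl, by simp⟩

theorem IsIdentityCell.whiskerRight {D : Type u₃} [Bicategory.{w₁, v₁} D] {x y z : D}
    {f g : x ⟶ y} {η : f ⟶ g} (hη : IsIdentityCell η) (k : y ⟶ z) : IsIdentityCell (η ▷ k) := by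
  obtain ⟨rfl, rfl⟩ := hη
  exact ⟨rfl, by simp⟩

theorem isIdentityCell_associator_hom {x y z t : C} (f : x ⟶ y) (g : y ⟶ z) (h : z ⟶ t) :
    IsIdentityCell (α_ f g h).hom :=
  ⟨Strict.assoc f g h, by rw [Strict.associator_eqToIso]; rfl⟩

theorem isIdentityCell_associator_inv {x y z t : C} (f : x ⟶ y) (g : y ⟶ z) (h : z ⟶ t) :
    IsIdentityCell (α_ f g h).inv :=
  ⟨(Strict.assoc f g h).symm, by rw [Strict.associator_eqToIso]; rfl⟩

theorem isIdentityCell_cat {X Y : Cat.{w, v}} {f g : X ⟶ Y} (η : f ⟶ g)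
    (h : ∀ x : X, ∃ e : f.toFunctor.obj x = g.toFunctor.obj x,
      η.toNatTrans.app x = eqToHom e) : IsIdentityCell η := by
  have hfg : f = g := by
    ext1
    refine CategoryTheory.Functor.ext (fun x => (h x).1) (fun x y k => ?_)
    have n := η.toNatTrans.naturality k
    rw [(h x).2, (h y).2] at n
    rw [← Category.assoc, ← n, Category.assoc, eqToHom_trans, eqToHom_refl, Category.comp_id]
  refine ⟨hfg, ?_⟩
  ext x
  rw [Cat.eqToHom_app]
  exact (h x).2

variable {K : StrictPseudofunctor B A}

/-- A lax natural transformation between 2-functors on `B` is cartesian-marked if its structure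
2-cells on the chosen opcartesian morphisms of `B` are identities. -/
def IsCartesianMarkedLax (S : SplitDiscreteTwoOpfibration K) {F G : StrictPseudofunctor B C}
    (l : Lax.LaxTrans F.toLax G.toLax) : Prop :=
  ∀ ⦃b b' : B⦄ (f : b ⟶ b'), S.split.IsChosen f → IsIdentityCell (l.naturality f)

/-- An oplax natural transformation between 2-functors `Bᵒᵖ ⥤ Cat` is cartesian-marked if its
structure 2-cells on the chosen opcartesian morphisms of `B` are identities. -/
def IsCartesianMarkedOplax (S : SplitDiscreteTwoOpfibration K)
    {V W : StrictPseudofunctor Bᵒᵖ Cat.{w, v}} (m : Lax.OplaxTrans V.toLax W.toLax) : Prop :=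
  ∀ ⦃b b' : B⦄ (f : b ⟶ b'), S.split.IsChosen f → IsIdentityCell (m.naturality f.op)

section
open scoped Lax.OplaxTrans

/-- The category `[Bᵒᵖ, Cat](V, W)` of cartesian-marked oplax natural transformations
and modifications. -/
abbrev CartesianMarkedOplax (S : SplitDiscreteTwoOpfibration K)
    (V W : StrictPseudofunctor Bᵒᵖ Cat.{w, v}) :=
  ObjectProperty.FullSubcategory
    (fun m : V.toLax ⟶ W.toLax => IsCartesianMarkedOplax S m)

/-- Postcomposition with a 2-cell `γ : g ⟶ g'`, as a modification. -/
def homPostcompModification (G : StrictPseudofunctor B C) {X Y : C} {g g' : X ⟶ Y} (γ : g ⟶ g') :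
    (show (homInto G X).toLax ⟶ (homInto G Y).toLax from homPostcomp G g) ⟶ homPostcomp G g' where
  as :=
    { app := fun b => ((postcomposing (G.obj b.unop) X Y).map γ).toCatHom₂
      naturality := fun {a b} f => by
        ext u
        exact postcomp_naturality_aux (G.map f.unop) u γ }

/-- The cocylinder `A(K(-), a) ⇒ C((L ∘ K)(-), L a) ⇒ C(F(-), L a)` given by the action of `L`
followed by precomposition with `l`. -/
def cocylinder {F : StrictPseudofunctor B C} {L : StrictPseudofunctor A C}
    (l : Lax.LaxTrans F.toLax (K.comp L).toLax) (a : A) :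
    (homInto K a).toLax ⟶ (homInto F (L.obj a)).toLax :=
  (show (homInto K a).toLax ⟶ (homInto (K.comp L) (L.obj a)).toLax from homMap K L a) ≫
    homPrecomp l (L.obj a)

theorem isCartesianMarkedOplax_comparison (S : SplitDiscreteTwoOpfibration K)
    {F : StrictPseudofunctor B C} {L : StrictPseudofunctor A C}
    {l : Lax.LaxTrans F.toLax (K.comp L).toLax} (hl : IsCartesianMarkedLax S l) (a : A) {c : C}
    (g : L.obj a ⟶ c) :
    IsCartesianMarkedOplax S (V := homInto K a) (W := homInto F c)
      (cocylinder l a ≫ homPostcomp F g) := by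
  intro b b' f hf
  have h₁ : IsIdentityCell ((homMap K L a).naturality f.op) :=
    isIdentityCell_cat _ fun u =>
      ⟨L.map_comp (K.map f) u, congrArg Iso.hom (L.mapComp_eq_eqToIso (K.map f) u)⟩
  have h₂ : IsIdentityCell ((homPrecomp l (L.obj a)).naturality f.op) :=
    isIdentityCell_cat _ fun u =>
      (isIdentityCell_associator_inv (l.app b) (L.map (K.map f)) u).comp
        (((hl f hf).whiskerRight u).comp (isIdentityCell_associator_hom (F.map f) (l.app b') u))
  have h₃ : IsIdentityCell ((homPostcomp F g).naturality f.op) :=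
    isIdentityCell_cat _ fun u => isIdentityCell_associator_hom (F.map f) u g
  have h₁₂ : IsIdentityCell ((cocylinder l a).naturality f.op) :=
    (isIdentityCell_associator_inv _ _ _).comp ((h₁.whiskerRight _).comp
      ((isIdentityCell_associator_hom _ _ _).comp ((h₂.whiskerLeft _).comp
        (isIdentityCell_associator_inv _ _ _))))
  exact (isIdentityCell_associator_inv _ _ _).comp ((h₁₂.whiskerRight _).comp
    ((isIdentityCell_associator_hom _ _ _).comp ((h₃.whiskerLeft _).comp
      (isIdentityCell_associator_inv _ _ _))))

/-- The functor `C(L a, c) ⥤ [Bᵒᵖ, Cat](A(K(-), a), C(F(-), c))` which postcomposes the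
cocylinder with 1-cells and 2-cells out of `L a`. -/
def comparison (S : SplitDiscreteTwoOpfibration K) {F : StrictPseudofunctor B C}
    {L : StrictPseudofunctor A C} {l : Lax.LaxTrans F.toLax (K.comp L).toLax}
    (hl : IsCartesianMarkedLax S l) (a : A) (c : C) :
    (L.obj a ⟶ c) ⥤ CartesianMarkedOplax S (homInto K a) (homInto F c) where
  obj g := ⟨cocylinder l a ≫ homPostcomp F g, isCartesianMarkedOplax_comparison S hl a g⟩
  map γ := ObjectProperty.homMk
    (Lax.OplaxTrans.whiskerLeft (cocylinder l a) (homPostcompModification F γ))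
  map_id g := by
    ext b u
    exact whiskerLeft_id (((cocylinder l a).app b).toFunctor.obj u) g
  map_comp γ δ := by
    ext b u
    exact Bicategory.whiskerLeft_comp (((cocylinder l a).app b).toFunctor.obj u) γ δ

/-- `l` exhibits `L` as the pointwise left Kan extension of `F` along the split discrete
2-opfibration `K`: `l` is cartesian-marked and every comparison functor is an isomorphism. -/
def IsPointwiseLeftKanExtension (S : SplitDiscreteTwoOpfibration K) (F : StrictPseudofunctor B C)
    (L : StrictPseudofunctor A C) (l : Lax.LaxTrans F.toLax (K.comp L).toLax) : Prop :=
  ∃ hl : IsCartesianMarkedLax S l, ∀ (a : A) (c : C), IsIsoOfCategories (comparison S hl a c)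

end

section
open scoped Lax.LaxTrans

/-- Restriction of a lax natural transformation along `K`. -/
def restrict (K : StrictPseudofunctor B A) {L U : StrictPseudofunctor A C}
    (φ : L.toLax ⟶ U.toLax) : (K.comp L).toLax ⟶ (K.comp U).toLax where
  app b := φ.app (K.obj b)
  naturality f := φ.naturality (K.map f)
  naturality_naturality η := φ.naturality_naturality (K.map₂ η)
  naturality_id b := lax_id_aux' ((K.comp U).map_id b) ((K.comp L).map_id b)
    (toLax_mapId _ b) (toLax_mapId _ b)
    (laxTrans_naturality_of_eq_id (F := L) (G := U) φ (K.map_id b))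
  naturality_comp f g := lax_comp_aux' ((K.comp U).map_comp f g) ((K.comp L).map_comp f g)
    (toLax_mapComp _ f g) (toLax_mapComp _ f g)
    (laxTrans_naturality_of_eq_comp (F := L) (G := U) φ (K.map_comp f g))

/-- Restriction of a modification along `K`. -/
def restrictModification (K : StrictPseudofunctor B A) {L U : StrictPseudofunctor A C}
    {φ ψ : L.toLax ⟶ U.toLax} (Γ : φ ⟶ ψ) : restrict K φ ⟶ restrict K ψ where
  as :=
    { app := fun b => Γ.as.app (K.obj b)
      naturality := fun f => Γ.as.naturality (K.map f) }

/-- Pasting with `l`: restriction along `K` followed by (vertical) precomposition with `l`, as a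
functor from the category of lax natural transformations `L ⇒ U` and modifications to that of lax
natural transformations `F ⇒ U ∘ K` and modifications. -/
def pasting {F : StrictPseudofunctor B C} {L : StrictPseudofunctor A C}
    (l : F.toLax ⟶ (K.comp L).toLax) (U : StrictPseudofunctor A C) :
    (L.toLax ⟶ U.toLax) ⥤ (F.toLax ⟶ (K.comp U).toLax) where
  obj φ := l ≫ restrict K φ
  map Γ := Lax.LaxTrans.whiskerLeft l (restrictModification K Γ)
  map_id φ := by
    ext b
    exact whiskerLeft_id (l.app b) (φ.app (K.obj b))
  map_comp Γ Γ' := by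
    ext b
    exact Bicategory.whiskerLeft_comp (l.app b) (Γ.as.app (K.obj b)) (Γ'.as.app (K.obj b))

/-- `l` exhibits `L` as the weak left Kan extension of `F` along `K`. -/
def IsWeakLeftKanExtension (F : StrictPseudofunctor B C)
    (L : StrictPseudofunctor A C) (l : Lax.LaxTrans F.toLax (K.comp L).toLax) : Prop :=
  ∀ U : StrictPseudofunctor A C, IsIsoOfCategories (pasting l U)

end
end
end TwoCat

/-! Fix `a`. An oplax transformation `A(K(-), a) ⇒ C(F(-), c)` amounts to a cocone on the lax slice
of `K` over `a`: a 1-cell `W u : F b ⟶ c` for each `u : K b ⟶ a`, and a 2-cell `W u ⟶ F f ≫ W u'`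
for each `f : b ⟶ b'` with `u ⟶ K f ≫ u'`. The pointwise hypothesis says that 1-cells and 2-cells
out of `L a` are the same as marked cocones and their morphisms.

A lax `ψ : F ⇒ U ∘ K` yields the cocone `u ↦ ψ b ≫ U u` with vertex `U a` (`hat`). It need not be
marked, so it is not directly represented by a 1-cell `L a ⟶ U a`. The remedy is a strict reflection
of cocones into marked ones (`reflect`). Its value at `u` is `F` of the chosen lift `b ⟶ t` of `u`,
followed by the value of `W` at the identification `K t = a`; thus it depends only on the fibre over
`a`. It is defined on 2-cells because discreteness lifts a cell `u ⟶ K f ≫ u'` to `B`, and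
opcartesianness factors the domain of the lift through the chosen lift of `u`. Strict compatibility
of the splitting with composition makes the result marked; compatibility with identities makes the
unit an identity on the fibre.

Two facts carry the rest. A marked cocone receiving from `W` a morphism that is the identity on the
fibre is equal to `W.reflect S` (`IsHom.eq_reflect`), and a morphism into a marked cocone is
determined by the fibre (`IsHom.eq_of_fibre`). Hence the 1-cell representing the reflection of `W`
(`Representation`) is unique on the nose, not merely up to isomorphism.

For a given `ψ`, the representing 1-cells `g a : L a ⟶ U a` are the components of the extension. Its
structure cell at `f : a ⟶ a'` comes from the universal property of `g a`, and the lax axioms need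
only be tested on fibres. Conversely, every lax `φ : L ⇒ U` represents the cocones of its pasting
with `l`, with comparison cells `l b ◁ φ u` (`representationOfLax`), so uniqueness makes pasting
injective on objects. The same universal property applied to 2-cells gives fullness and
faithfulness. -/

namespace TwoCat

set_option linter.unusedSectionVars false

/-! ### Morphisms compared up to equality of their endpoints -/

section
variable {D : Type u} [Category.{v} D]

/-- Equality of morphisms up to equality of their domains and of their codomains. -/
inductive CellEq : ∀ {f g f' g' : D}, (f ⟶ g) → (f' ⟶ g') → Prop
  | refl {f g : D} (η : f ⟶ g) : CellEq η η

infix:50 "≋" => CellEq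

namespace CellEq

variable {f g h f' g' h' f'' g'' : D}

theorem of_eq {η θ : f ⟶ g} (e : η = θ) : η ≋ θ := e ▸ .refl η

theorem eq {η θ : f ⟶ g} (e : η ≋ θ) : η = θ := by
  cases e
  rfl

theorem symm {η : f ⟶ g} {θ : f' ⟶ g'} (e : η ≋ θ) : θ ≋ η := by
  cases e
  exact .refl _

theorem trans {η : f ⟶ g} {θ : f' ⟶ g'} {ζ : f'' ⟶ g''} (e : η ≋ θ) (e' : θ ≋ ζ) : η ≋ ζ := by
  cases e
  exact e'

theorem dom {η : f ⟶ g} {θ : f' ⟶ g'} (e : η ≋ θ) : f = f' := by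
  cases e
  rfl

theorem cod {η : f ⟶ g} {θ : f' ⟶ g'} (e : η ≋ θ) : g = g' := by
  cases e
  rfl

theorem comp {η : f ⟶ g} {θ : g ⟶ h} {η' : f' ⟶ g'} {θ' : g' ⟶ h'} (e : η ≋ η') (e' : θ ≋ θ') :
    η ≫ θ ≋ η' ≫ θ' := by
  cases e
  cases e'
  exact .refl _

theorem id (e : f = f') : 𝟙 f ≋ 𝟙 f' := by
  cases e
  exact .refl _

theorem eqToHom (e : f = f') : eqToHom e ≋ 𝟙 f := by
  cases e
  exact .refl _

/-- The relation `θ ≋ 𝟙 g` expresses that `θ` is an identity although its codomain may be written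
differently. With `id_comp`, this absorbs associators, unitors and `eqToHom`s throughout. -/
theorem comp_id {η : f ⟶ g} {θ : g ⟶ h} (e : θ ≋ 𝟙 g) : η ≫ θ ≋ η := by
  obtain rfl := e.cod
  obtain rfl := e.eq
  exact of_eq (Category.comp_id η)

theorem id_comp {η : f ⟶ g} {θ : g ⟶ h} (e : η ≋ 𝟙 f) : η ≫ θ ≋ θ := by
  obtain rfl := e.cod
  obtain rfl := e.eq
  exact of_eq (Category.id_comp θ)

theorem comp_eq_id {η : f ⟶ g} {θ : g ⟶ h} (e : η ≋ 𝟙 f) (e' : θ ≋ 𝟙 g) : η ≫ θ ≋ 𝟙 f :=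
  (comp_id e').trans e

/-- Congruence for composites through an identification of 1-cells. -/
theorem comp_comp {η : f ⟶ g} {κ : g ⟶ h} {θ : h ⟶ f''} {η' : f' ⟶ g'} {θ' : g' ⟶ g''}
    (e : η ≋ η') (hκ : κ ≋ 𝟙 g) (e' : θ ≋ θ') : η ≫ κ ≫ θ ≋ η' ≫ θ' :=
  e.comp ((id_comp hκ).trans e')

theorem map {E : Type u₁} [Category.{v₁} E] (F : D ⥤ E) {η : f ⟶ g} {θ : f' ⟶ g'} (e : η ≋ θ) :
    F.map η ≋ F.map θ := by
  cases e
  exact .refl _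

theorem eq_conj {η : f ⟶ g} {θ : f' ⟶ g'} (e : η ≋ θ) (h₁ : f = f') (h₂ : g' = g) :
    η = CategoryTheory.eqToHom h₁ ≫ θ ≫ CategoryTheory.eqToHom h₂ := by
  cases e
  simp

theorem eq_eqToHom {η : f ⟶ g} (e : η ≋ 𝟙 f) (h : f = g) : η = CategoryTheory.eqToHom h := by
  subst h
  exact e.eq

end CellEq

end

/-! ### The same calculus for whiskering and for strict 2-functors -/

section
variable {C : Type u} [Bicategory.{w, v} C]

namespace CellEq

theorem whiskerLeft {x y z : C} {k k' : x ⟶ y} (e : k = k') {f g f' g' : y ⟶ z} {η : f ⟶ g}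
    {η' : f' ⟶ g'} (e' : η ≋ η') : k ◁ η ≋ k' ◁ η' := by
  cases e
  cases e'
  exact .refl _

theorem whiskerRight {x y z : C} {f g f' g' : x ⟶ y} {η : f ⟶ g} {η' : f' ⟶ g'} (e' : η ≋ η')
    {k k' : y ⟶ z} (e : k = k') : η ▷ k ≋ η' ▷ k' := by
  cases e
  cases e'
  exact .refl _

theorem whiskerLeft_id {x y z : C} (k : x ⟶ y) {f g : y ⟶ z} {η : f ⟶ g} (e : η ≋ 𝟙 f) :
    k ◁ η ≋ 𝟙 (k ≫ f) := by
  obtain rfl := e.cod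
  obtain rfl := e.eq
  exact of_eq (Bicategory.whiskerLeft_id k _)

theorem id_whiskerRight {x y z : C} {f g : x ⟶ y} {η : f ⟶ g} (e : η ≋ 𝟙 f) (k : y ⟶ z) :
    η ▷ k ≋ 𝟙 (f ≫ k) := by
  obtain rfl := e.cod
  obtain rfl := e.eq
  exact of_eq (Bicategory.id_whiskerRight _ k)

theorem isIdentityCell {x y : C} {f g : x ⟶ y} {η : f ⟶ g} (e : η ≋ 𝟙 f) : IsIdentityCell η :=
  ⟨e.cod.symm, e.eq_eqToHom _⟩

end CellEq

theorem IsIdentityCell.cellEq {x y : C} {f g : x ⟶ y} {η : f ⟶ g} (h : IsIdentityCell η) :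
    η ≋ 𝟙 f := by
  obtain ⟨rfl, rfl⟩ := h
  exact .refl _

variable [Strict C]

namespace CellEq

theorem associator_hom {x y z t : C} (f : x ⟶ y) (g : y ⟶ z) (h : z ⟶ t) :
    (α_ f g h).hom ≋ 𝟙 ((f ≫ g) ≫ h) :=
  (isIdentityCell_associator_hom f g h).cellEq

theorem associator_inv {x y z t : C} (f : x ⟶ y) (g : y ⟶ z) (h : z ⟶ t) :
    (α_ f g h).inv ≋ 𝟙 (f ≫ g ≫ h) :=
  (isIdentityCell_associator_inv f g h).cellEq

theorem id_whiskerLeft {x y : C} {f g : x ⟶ y} (η : f ⟶ g) : 𝟙 x ◁ η ≋ η := by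
  rw [id_whiskerLeft_strict]
  exact (id_comp (.eqToHom _)).trans (comp_id (.eqToHom _))

theorem whiskerRight_id {x y : C} {f g : x ⟶ y} (η : f ⟶ g) : η ▷ 𝟙 y ≋ η := by
  rw [Bicategory.whiskerRight_id, Strict.rightUnitor_eqToIso, Strict.rightUnitor_eqToIso]
  exact (id_comp (.eqToHom (Strict.comp_id f))).trans
    (comp_id (.eqToHom (Strict.comp_id g).symm))

theorem comp_whiskerLeft {x y z t : C} (f : x ⟶ y) (g : y ⟶ z) {h k : z ⟶ t} (η : h ⟶ k) :
    (f ≫ g) ◁ η ≋ f ◁ g ◁ η := by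
  rw [comp_whiskerLeft_strict]
  exact (id_comp (.eqToHom _)).trans (comp_id (.eqToHom _))

theorem whiskerRight_comp {x y z t : C} {f g : x ⟶ y} (η : f ⟶ g) (h : y ⟶ z) (k : z ⟶ t) :
    η ▷ (h ≫ k) ≋ η ▷ h ▷ k := by
  rw [whiskerRight_comp_strict]
  exact (id_comp (.eqToHom _)).trans (comp_id (.eqToHom _))

theorem whisker_assoc {x y z t : C} (k : x ⟶ y) {f g : y ⟶ z} (η : f ⟶ g) (h : z ⟶ t) :
    (k ◁ η) ▷ h ≋ k ◁ (η ▷ h) := by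
  rw [whisker_assoc_strict]
  exact (id_comp (.eqToHom _)).trans (comp_id (.eqToHom _))

end CellEq

variable {B : Type u₁} [Bicategory.{w₁, v₁} B] [Strict B] (G : StrictPseudofunctor B C)

namespace CellEq

theorem map₂ {x y : B} {f g f' g' : x ⟶ y} {η : f ⟶ g} {θ : f' ⟶ g'} (e : η ≋ θ) :
    G.map₂ η ≋ G.map₂ θ := by
  cases e
  exact .refl _

theorem map₂_id {x y : B} {f g : x ⟶ y} {η : f ⟶ g} (e : η ≋ 𝟙 f) : G.map₂ η ≋ 𝟙 (G.map f) := by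
  obtain rfl := e.cod
  obtain rfl := e.eq
  exact of_eq (G.map₂_id _)

theorem mapComp_hom {x y z : B} (f : x ⟶ y) (g : y ⟶ z) :
    (G.mapComp f g).hom ≋ 𝟙 (G.map (f ≫ g)) := by
  rw [G.mapComp_eq_eqToIso]
  exact .eqToHom (by rw [G.map_comp])

theorem mapComp_inv {x y z : B} (f : x ⟶ y) (g : y ⟶ z) :
    (G.mapComp f g).inv ≋ 𝟙 (G.map f ≫ G.map g) := by
  rw [G.mapComp_eq_eqToIso]
  exact .eqToHom (by rw [G.map_comp])

theorem map₂_whiskerLeft {x y z : B} (k : x ⟶ y) {f g : y ⟶ z} (η : f ⟶ g) :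
    G.map₂ (k ◁ η) ≋ G.map k ◁ G.map₂ η := by
  rw [G.map₂_whisker_left]
  exact (id_comp (mapComp_hom _ _ _)).trans (comp_id (mapComp_inv _ _ _))

theorem map₂_whiskerRight {x y z : B} {f g : x ⟶ y} (η : f ⟶ g) (k : y ⟶ z) :
    G.map₂ (η ▷ k) ≋ G.map₂ η ▷ G.map k := by
  rw [G.map₂_whisker_right]
  exact (id_comp (mapComp_hom _ _ _)).trans (comp_id (mapComp_inv _ _ _))

end CellEq

end

/-! ### Cocones on the lax slice -/

section
variable {B : Type u₁} [Bicategory.{w₁, v₁} B] [Strict B]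
  {A : Type u₂} [Bicategory.{w, v} A] [Strict A]
  {C : Type u} [Bicategory.{w, v} C] [Strict C]

theorem CellEq.map_id_whiskerLeft (G : StrictPseudofunctor B C) {b : B} {x : C}
    {f g : G.obj b ⟶ x} (η : f ⟶ g) : G.map (𝟙 b) ◁ η ≋ η :=
  (CellEq.whiskerLeft (G.map_id b) (.refl η)).trans (.id_whiskerLeft η)

/-- The data of an oplax natural transformation `A(K(-), a) ⇒ C(F(-), c)`, presented as a cocone on
the lax slice of `K` over `a`: its action on 2-cells and its structure 2-cells are combined into
`map`. -/
structure SliceCocone (K : StrictPseudofunctor B A) (F : StrictPseudofunctor B C) (a : A)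
    (c : C) where
  obj : ∀ {b : B}, (K.obj b ⟶ a) → (F.obj b ⟶ c)
  map : ∀ {b b' : B} (f : b ⟶ b') {u : K.obj b ⟶ a} {u' : K.obj b' ⟶ a}
    (_ : u ⟶ K.map f ≫ u'), obj u ⟶ F.map f ≫ obj u'
  map_id : ∀ {b : B} {u : K.obj b ⟶ a} {η : u ⟶ K.map (𝟙 b) ≫ u}, η ≋ 𝟙 u →
    map (𝟙 b) η ≋ 𝟙 (obj u)
  map_comp : ∀ {b b' b'' : B} (f : b ⟶ b') (g : b' ⟶ b'') {u : K.obj b ⟶ a} {u' : K.obj b' ⟶ a}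
    {u'' : K.obj b'' ⟶ a} (η : u ⟶ K.map f ≫ u') (ζ : u' ⟶ K.map g ≫ u'')
    {ξ : u ⟶ K.map (f ≫ g) ≫ u''}, ξ ≋ η ≫ K.map f ◁ ζ →
    map (f ≫ g) ξ ≋ map f η ≫ F.map f ◁ map g ζ
  map_cell : ∀ {b b' : B} {f f' : b ⟶ b'} (κ : f ⟶ f') {u : K.obj b ⟶ a} {u' : K.obj b' ⟶ a}
    (η : u ⟶ K.map f ≫ u'),
    map f η ≫ F.map₂ κ ▷ obj u' = map f' (η ≫ K.map₂ κ ▷ u')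

variable {K : StrictPseudofunctor B A} {F : StrictPseudofunctor B C}

namespace SliceCocone

variable {a : A} {c : C}

theorem ext_of_cellEq {V W : SliceCocone K F a c}
    (h : ∀ {b : B} (u : K.obj b ⟶ a), V.obj u = W.obj u)
    (h' : ∀ {b b' : B} (f : b ⟶ b') {u : K.obj b ⟶ a} {u' : K.obj b' ⟶ a}
      (η : u ⟶ K.map f ≫ u'), V.map f η ≋ W.map f η) : V = W := by
  obtain ⟨o, m, _, _, _⟩ := V
  obtain ⟨o', m', _, _, _⟩ := W
  obtain rfl : @o = @o' := by
    funext b u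
    exact h u
  obtain rfl : @m = @m' := by
    funext b b' f u u' η
    exact (h' f η).eq
  rfl

theorem map_congr (W : SliceCocone K F a c) {b b' : B} {f f' : b ⟶ b'} (hf : f = f')
    {u u₁ : K.obj b ⟶ a} {u' u₁' : K.obj b' ⟶ a} {η : u ⟶ K.map f ≫ u'}
    {η₁ : u₁ ⟶ K.map f' ≫ u₁'} (hu : u' = u₁') (h : η ≋ η₁) : W.map f η ≋ W.map f' η₁ := by
  subst hf hu
  obtain rfl := h.dom
  obtain rfl := h.eq
  exact .refl _

theorem map_of_eq_comp (W : SliceCocone K F a c) {b b' b'' : B} {f : b ⟶ b'} {g : b' ⟶ b''}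
    {k : b ⟶ b''} (hk : k = f ≫ g) {u : K.obj b ⟶ a} {u' : K.obj b' ⟶ a}
    {u'' : K.obj b'' ⟶ a} (η : u ⟶ K.map f ≫ u') (ζ : u' ⟶ K.map g ≫ u'')
    {ξ : u ⟶ K.map k ≫ u''} (h : ξ ≋ η ≫ K.map f ◁ ζ) :
    W.map k ξ ≋ W.map f η ≫ F.map f ◁ W.map g ζ := by
  subst hk
  exact W.map_comp f g η ζ h

theorem map_eq_id (W : SliceCocone K F a c) {b : B} {f : b ⟶ b} (hf : f = 𝟙 b)
    {u u' : K.obj b ⟶ a} (hu : u' = u) {η : u ⟶ K.map f ≫ u'} (h : η ≋ 𝟙 u) :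
    W.map f η ≋ 𝟙 (W.obj u) := by
  subst hf hu
  exact W.map_id h

/-- The action of a slice cocone on the 2-cells `u ⟶ u'`. -/
def cell (W : SliceCocone K F a c) {b : B} {u u' : K.obj b ⟶ a} (η : u ⟶ u') :
    W.obj u ⟶ W.obj u' :=
  W.map (𝟙 b) (η ≫ eqToHom (map_id_comp K u').symm) ≫ eqToHom (map_id_comp F (W.obj u'))

theorem cell_cellEq (W : SliceCocone K F a c) {b : B} {u u' : K.obj b ⟶ a} (η : u ⟶ u')
    {ξ : u ⟶ K.map (𝟙 b) ≫ u'} (h : ξ ≋ η) : W.cell η ≋ W.map (𝟙 b) ξ :=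
  (CellEq.comp_id (.eqToHom _)).trans
    (W.map_congr rfl rfl ((CellEq.comp_id (.eqToHom _)).trans h.symm))

/-- The composition axiom with first 1-cell `𝟙 b`. Together with `map_comp_cell`, where the second
1-cell is an identity, it supplies the functoriality and naturality required by `toOplax`. -/
theorem cell_comp_map (W : SliceCocone K F a c) {b b' : B} (f : b ⟶ b') {u u₁ : K.obj b ⟶ a}
    {u' : K.obj b' ⟶ a} (η : u ⟶ u₁) (ζ : u₁ ⟶ K.map f ≫ u') :
    W.cell η ≫ W.map f ζ = W.map f (η ≫ ζ) := by
  refine CellEq.eq (CellEq.symm ?_)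
  have h : η ≫ eqToHom (map_id_comp K u₁).symm ≋ η := .comp_id (.eqToHom _)
  refine (W.map_of_eq_comp (Strict.id_comp f).symm (η ≫ eqToHom (map_id_comp K u₁).symm) ζ
    (CellEq.comp h (.map_id_whiskerLeft K ζ)).symm).trans ?_
  exact CellEq.comp (W.cell_cellEq η h).symm (.map_id_whiskerLeft F _)

theorem map_comp_cell (W : SliceCocone K F a c) {b b' : B} (f : b ⟶ b') {u : K.obj b ⟶ a}
    {u' u₁ : K.obj b' ⟶ a} (η : u ⟶ K.map f ≫ u') (ζ : u' ⟶ u₁) :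
    W.map f η ≫ F.map f ◁ W.cell ζ = W.map f (η ≫ K.map f ◁ ζ) := by
  refine CellEq.eq (CellEq.symm ?_)
  have h : ζ ≫ eqToHom (map_id_comp K u₁).symm ≋ ζ := .comp_id (.eqToHom _)
  refine (W.map_of_eq_comp (Strict.comp_id f).symm η (ζ ≫ eqToHom (map_id_comp K u₁).symm)
    (CellEq.comp (.refl η) (CellEq.whiskerLeft rfl h)).symm).trans ?_
  exact CellEq.comp (.refl _) (CellEq.whiskerLeft rfl (W.cell_cellEq ζ h).symm)

theorem cell_id (W : SliceCocone K F a c) {b : B} (u : K.obj b ⟶ a) :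
    W.cell (𝟙 u) = 𝟙 (W.obj u) := by
  have h : eqToHom (map_id_comp K u).symm ≋ 𝟙 u := .eqToHom _
  exact ((W.cell_cellEq (𝟙 u) h).trans (W.map_id h)).eq

theorem cell_comp (W : SliceCocone K F a c) {b : B} {u u' u'' : K.obj b ⟶ a} (η : u ⟶ u')
    (θ : u' ⟶ u'') : W.cell (η ≫ θ) = W.cell η ≫ W.cell θ := by
  change _ = W.cell η ≫ W.map (𝟙 b) _ ≫ eqToHom _
  rw [← Category.assoc (W.cell η), cell_comp_map, ← Category.assoc, cell]

/-- The oplax natural transformation `A(K(-), a) ⇒ C(F(-), c)` presented by a slice cocone. -/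
def toOplax (W : SliceCocone K F a c) :
    Lax.OplaxTrans (homInto K a).toLax (homInto F c).toLax :=
  mkOplax (G := K) (G' := F) (X := a) (Y := c)
    (fun b =>
      { obj := fun u => W.obj u
        map := fun η => W.cell η
        map_id := fun u => W.cell_id u
        map_comp := fun η θ => W.cell_comp η θ })
    (fun f =>
      { app := fun u => W.map f (𝟙 (K.map f ≫ u))
        naturality := fun u v η => by
          change W.cell (K.map f ◁ η) ≫ W.map f (𝟙 (K.map f ≫ v)) =
            W.map f (𝟙 (K.map f ≫ u)) ≫ F.map f ◁ W.cell η
          rw [cell_comp_map, map_comp_cell, Category.comp_id, Category.id_comp] })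
    (fun {b b' f g} η u => by
      change W.cell (K.map₂ η ▷ u) ≫ W.map g (𝟙 (K.map g ≫ u)) =
        W.map f (𝟙 (K.map f ≫ u)) ≫ F.map₂ η ▷ W.obj u
      rw [cell_comp_map, map_cell, Category.comp_id, Category.id_comp])
    (fun b u (h : W.obj (K.map (𝟙 b) ≫ u) = F.map (𝟙 b) ≫ W.obj u) =>
      ((W.map_eq_id rfl (map_id_comp K u).symm (.refl _)).eq_eqToHom h))
    (fun {b b' b''} f g u h₁ h₂ => by
      have e : 𝟙 (K.map (f ≫ g) ≫ u) ≋
          eqToHom (map_comp_comp K f g u) ≫ K.map f ◁ 𝟙 (K.map g ≫ u) :=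
        ((CellEq.comp_id (.whiskerLeft_id _ (.refl _))).trans (.eqToHom _)).symm
      have e' := (W.map_comp f g (u' := K.map g ≫ u) _ _ e).trans
        (CellEq.comp (W.map_congr (η₁ := 𝟙 (K.map f ≫ K.map g ≫ u)) rfl rfl
          ((CellEq.eqToHom _).trans (.id (map_comp_comp K f g u)))) (.refl _))
      exact (e'.eq_conj h₁ h₂).trans (congrArg _ (Category.assoc _ _ _)))

/-- Postcomposition of a slice cocone with a 1-cell. -/
def postcomp (W : SliceCocone K F a c) {d : C} (g : c ⟶ d) : SliceCocone K F a d where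
  obj u := W.obj u ≫ g
  map f _ _ η := W.map f η ▷ g ≫ (α_ _ _ _).hom
  map_id h := (CellEq.comp_id (.associator_hom _ _ _)).trans
    ((CellEq.whiskerRight (W.map_id h) rfl).trans (.id_whiskerRight (.refl _) g))
  map_comp {b b' b''} f f' {u u' u''} η ζ ξ h := by
    have e₁ : (F.map f ◁ W.map f' ζ) ▷ g ≋
        F.map f ◁ (W.map f' ζ ▷ g ≫ (α_ (F.map f') (W.obj u'') g).hom) :=
      (CellEq.whisker_assoc _ _ _).trans
        (CellEq.whiskerLeft rfl (CellEq.comp_id (.associator_hom _ _ _)).symm)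
    have e₂ : W.map f η ▷ g ≋ W.map f η ▷ g ≫ (α_ (F.map f) (W.obj u') g).hom :=
      (CellEq.comp_id (.associator_hom _ _ _)).symm
    refine (CellEq.comp_id (.associator_hom _ _ _)).trans
      ((CellEq.whiskerRight (W.map_comp f f' η ζ h) rfl).trans ?_)
    rw [comp_whiskerRight]
    exact e₂.comp e₁
  map_cell {_ _ _ _} κ {_ _} η := by
    rw [← W.map_cell]
    simp

theorem postcomp_map (W : SliceCocone K F a c) {d : C} (g : c ⟶ d) {b b' : B} (f : b ⟶ b')
    {u : K.obj b ⟶ a} {u' : K.obj b' ⟶ a} (η : u ⟶ K.map f ≫ u') :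
    (W.postcomp g).map f η ≋ W.map f η ▷ g :=
  .comp_id (.associator_hom _ _ _)

end SliceCocone

/-- Interchange of `m` with `ζ`. The structure cells of both `hat` and `reflect` are pastings of
this shape, so this reduces their composition axioms to separate statements about the `η` part and
the `m` part. -/
theorem whisker_square_comp {x x' x'' y y' y'' z : C} {k : y ⟶ y'} {k' : y' ⟶ y''} {p : x ⟶ x'}
    {p' : x' ⟶ x''} {l : x ⟶ y} {l' : x' ⟶ y'} {l'' : x'' ⟶ y''} {s : y ⟶ z} {s' : y' ⟶ z}
    {s'' : y'' ⟶ z} (η : s ⟶ k ≫ s') (ζ : s' ⟶ k' ≫ s'') (m : l ≫ k ⟶ p ≫ l')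
    (m' : l' ≫ k' ⟶ p' ≫ l'') :
    (l ◁ η ≫ (α_ _ _ _).inv ≫ m ▷ s' ≫ (α_ _ _ _).hom) ≫
        p ◁ (l' ◁ ζ ≫ (α_ _ _ _).inv ≫ m' ▷ s'' ≫ (α_ _ _ _).hom) =
      l ◁ (η ≫ k ◁ ζ) ≫ (l ◁ (α_ k k' s'').inv ≫ (α_ _ _ _).inv ≫ (α_ _ _ _).inv ▷ s'') ≫
        (m ▷ k' ≫ (α_ _ _ _).hom ≫ p ◁ m') ▷ s'' ≫ (α_ _ _ _).hom ≫ p ◁ (α_ _ _ _).hom :=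
  calc
    _ = 𝟙 _ ⊗≫ l ◁ η ⊗≫ (m ▷ s' ≫ (p ≫ l') ◁ ζ) ⊗≫ p ◁ m' ▷ s'' ⊗≫ 𝟙 _ := by bicategory
    _ = _ := by
      rw [← whisker_exchange]
      bicategory

/-! ### The slice cocone of a lax transformation into `U ∘ K` -/

section
variable {U : StrictPseudofunctor A C} (ψ : Lax.LaxTrans F.toLax (K.comp U).toLax)

/-- The components of a lax natural transformation `F ⇒ U ∘ K`. -/
def laxApp (b : B) : F.obj b ⟶ U.obj (K.obj b) := ψ.app b

/-- The structure 2-cells of a lax natural transformation `F ⇒ U ∘ K`. -/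
def laxNat {b b' : B} (f : b ⟶ b') :
    laxApp ψ b ≫ U.map (K.map f) ⟶ F.map f ≫ laxApp ψ b' := ψ.naturality f

theorem laxNat_id (b : B) : laxNat ψ (𝟙 b) ≋ 𝟙 (laxApp ψ b) := by
  have h : laxApp ψ b ≫ U.map (K.map (𝟙 b)) = laxApp ψ b := by
    rw [K.map_id, U.map_id, Strict.comp_id]
  refine CellEq.trans (CellEq.of_eq (laxTrans_naturality_id ψ b ?_))
    ((CellEq.eqToHom _).trans (.id h))
  exact h.trans (map_id_comp F (laxApp ψ b)).symm

theorem laxNat_comp {b b' b'' : B} (f : b ⟶ b') (g : b' ⟶ b'') :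
    laxNat ψ (f ≫ g) ≋ laxNat ψ f ▷ U.map (K.map g) ≫ (α_ _ _ _).hom ≫
      F.map f ◁ laxNat ψ g := by
  have h : laxApp ψ b ≫ U.map (K.map (f ≫ g)) =
      (laxApp ψ b ≫ U.map (K.map f)) ≫ U.map (K.map g) := by
    rw [K.map_comp, U.map_comp, Strict.assoc]
  refine CellEq.trans (CellEq.of_eq (laxTrans_naturality_comp ψ f g h
    (map_comp_comp F f g (laxApp ψ b'')).symm)) ?_
  refine (CellEq.id_comp (.eqToHom _)).trans (.comp (.refl _) ?_)
  exact CellEq.comp ((CellEq.eqToHom _).trans (CellEq.associator_hom _ _ _).symm)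
    (.comp_id (.eqToHom _))

theorem laxNat_cell {b b' : B} {f g : b ⟶ b'} (κ : f ⟶ g) :
    laxNat ψ f ≫ F.map₂ κ ▷ laxApp ψ b' = laxApp ψ b ◁ U.map₂ (K.map₂ κ) ≫ laxNat ψ g :=
  ψ.naturality_naturality κ

/-- The slice cocone over `a` induced by a lax natural transformation `ψ : F ⇒ U ∘ K`: it sends
`u : K b ⟶ a` to `ψ b ≫ U u`. -/
def hat (a : A) : SliceCocone K F a (U.obj a) where
  obj {b} u := laxApp ψ b ≫ U.map u
  map {b b'} f {u u'} η := laxApp ψ b ◁ (U.map₂ η ≫ (U.mapComp (K.map f) u').hom) ≫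
    (α_ _ _ _).inv ≫ laxNat ψ f ▷ U.map u' ≫ (α_ _ _ _).hom
  map_id {b u η} h := by
    have e₁ : U.map₂ η ≫ (U.mapComp (K.map (𝟙 b)) u).hom ≋ 𝟙 (U.map u) :=
      (CellEq.comp_id (.mapComp_hom _ _ _)).trans (.map₂_id U h)
    exact .comp_eq_id (.whiskerLeft_id _ e₁) (.comp_eq_id (.associator_inv _ _ _)
      (.comp_eq_id (.id_whiskerRight ((laxNat_id ψ b).trans (.id (laxNat_id ψ b).dom.symm)) _)
        (.associator_hom _ _ _)))
  map_comp {b b' b''} f f' {u u' u''} η ζ ξ h := by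
    have e₁ : U.map₂ ξ ≫ (U.mapComp (K.map (f ≫ f')) u'').hom ≋
        (U.map₂ η ≫ (U.mapComp (K.map f) u').hom) ≫
          U.map (K.map f) ◁ (U.map₂ ζ ≫ (U.mapComp (K.map f') u'').hom) := by
      refine (CellEq.comp_id (.mapComp_hom _ _ _)).trans ((CellEq.map₂ U h).trans ?_)
      rw [U.map₂_comp]
      refine CellEq.comp (CellEq.comp_id (.mapComp_hom _ _ _)).symm ?_
      refine (CellEq.map₂_whiskerLeft U _ _).trans (CellEq.whiskerLeft rfl ?_)
      exact (CellEq.comp_id (.mapComp_hom _ _ _)).symm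
    rw [whisker_square_comp]
    refine CellEq.comp (.whiskerLeft rfl e₁) ?_
    refine (CellEq.id_comp (.associator_inv _ _ _)).trans ?_
    refine CellEq.trans ?_ (CellEq.id_comp (.comp_eq_id
      (.whiskerLeft_id _ (.associator_inv _ _ _)) (.comp_eq_id (.associator_inv _ _ _)
        (.id_whiskerRight (.associator_inv _ _ _) _)))).symm
    exact (CellEq.comp_id (.associator_hom _ _ _)).trans ((CellEq.whiskerRight
      (laxNat_comp ψ f f') rfl).trans (CellEq.comp_id (.comp_eq_id (.associator_hom _ _ _)
        (.whiskerLeft_id _ (.associator_hom _ _ _)))).symm)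
  map_cell {b b' f f'} κ {u u'} η := by
    have e := congrArg (· ▷ U.map u') (laxNat_cell ψ κ)
    simp only [comp_whiskerRight] at e
    simp only [Category.assoc, ← associator_naturality_left, reassoc_of% e, U.map₂_comp,
      U.map₂_whisker_right, Bicategory.whiskerLeft_comp]
    simp

theorem hat_map (a : A) {b b' : B} (f : b ⟶ b') {u : K.obj b ⟶ a} {u' : K.obj b' ⟶ a}
    (η : u ⟶ K.map f ≫ u') (h : laxApp ψ b ≫ U.map (K.map f ≫ u') =
      (laxApp ψ b ≫ U.map (K.map f)) ≫ U.map u') :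
    (hat ψ a).map f η ≋ laxApp ψ b ◁ U.map₂ η ≫ eqToHom h ≫ laxNat ψ f ▷ U.map u' := by
  refine CellEq.comp (.whiskerLeft rfl (.comp_id (.mapComp_hom _ _ _))) ?_
  exact (CellEq.id_comp (.associator_inv _ _ _)).trans ((CellEq.comp_id
    (.associator_hom _ _ _)).trans (CellEq.id_comp (.eqToHom _)).symm)

end

end

/-! ### Factorization through the chosen opcartesian lifts -/

section
variable {B : Type u₁} [Bicategory.{w₁, v₁} B] [Strict B]
  {A : Type u₂} [Bicategory.{w, v} A] [Strict A] {K : StrictPseudofunctor B A}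

theorem isHomLift_iff_map_comp_eqToHom {b t : B} {a : A} (u : K.obj b ⟶ a) (p : b ⟶ t)
    (e : K.obj t = a) : K.toFunctor.IsHomLift u p ↔ K.map p ≫ eqToHom e = u := by
  subst e
  constructor
  · intro h
    have := @IsHomLift.eq_of_isHomLift _ _ _ _ K.toFunctor _ _ u p h
    subst this
    exact Strict.comp_id _
  · intro h
    obtain rfl : K.map p = u := (Strict.comp_id _).symm.trans h
    exact IsHomLift.map K.toFunctor p

theorem isHomLift_id_iff {t t' : B} {a : A} (v : t ⟶ t') (e : K.obj t = a) (e' : K.obj t' = a) :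
    K.toFunctor.IsHomLift (𝟙 a) v ↔ K.map v ≫ eqToHom e' = eqToHom e := by
  subst e
  exact isHomLift_iff_map_comp_eqToHom (𝟙 _) v e'

theorem isHomLift_mapFunctor_iff {b t : B} {g h : b ⟶ t} (θ : g ⟶ h) {u : K.obj b ⟶ K.obj t}
    (η : u ⟶ K.map h) : (K.mapFunctor b t).IsHomLift η θ ↔ K.map₂ θ ≋ η := by
  constructor
  · intro H
    have := @IsHomLift.domain_eq _ _ _ _ (K.mapFunctor b t) _ _ _ _ η θ H
    change K.map g = u at this
    subst this
    have := @IsHomLift.eq_of_isHomLift _ _ _ _ (K.mapFunctor b t) _ _ η θ H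
    subst this
    exact .refl _
  · intro H
    obtain rfl := H.dom
    obtain rfl := H.eq
    exact IsHomLift.map (K.mapFunctor b t) θ

/-- The discrete fibration on homs lifts `η` to a 2-cell with codomain `f ≫ p'`. Its domain lies
over `u`, so opcartesianness of `p` factors it as `p ≫ v` with `v` over the identity of `a`. -/
theorem exists_cocartesian_factor (S : SplitDiscreteTwoOpfibration K) {b b' t t' : B} {a : A}
    {u : K.obj b ⟶ a} {u' : K.obj b' ⟶ a} {p : b ⟶ t} {p' : b' ⟶ t'}
    (hp : K.toFunctor.IsStronglyCocartesian u p) (e : K.obj t = a) (e' : K.obj t' = a)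
    (hp' : K.map p' ≫ eqToHom e' = u') (f : b ⟶ b') (η : u ⟶ K.map f ≫ u') :
    ∃ (v : t ⟶ t') (θ : p ≫ v ⟶ f ≫ p'),
      K.map v ≫ eqToHom e' = eqToHom e ∧ K.map₂ θ ▷ eqToHom e' ≋ η := by
  subst e'
  obtain rfl : K.map p' = u' := (Strict.comp_id _).symm.trans hp'
  obtain ⟨⟨g, θ⟩, hθ, -⟩ := S.isDiscreteFibration b t' (f ≫ p')
    (η ≫ eqToHom (K.map_comp f p').symm)
  have hθ := (isHomLift_mapFunctor_iff θ _).1 hθ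
  obtain rfl := hθ.dom
  obtain ⟨v, ⟨hv, rfl⟩, -⟩ := @Functor.IsStronglyCocartesian.universal_property _ _ _ _
    K.toFunctor _ _ _ _ _ p hp _ _ (𝟙 _) (K.map g) (Strict.comp_id _).symm g
    (IsHomLift.map K.toFunctor g)
  exact ⟨v, θ, (isHomLift_id_iff v e rfl).1 hv,
    (CellEq.whiskerRight_id _).trans (hθ.trans (CellEq.comp_id (.eqToHom _)))⟩

/-- Uniqueness of the lifted 2-cell comes first and gives `p ≫ v = p ≫ v'`; opcartesianness then
cancels `p`. -/
theorem cocartesian_factor_unique (S : SplitDiscreteTwoOpfibration K) {b b' t t' : B} {a : A}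
    {u : K.obj b ⟶ a} {u' : K.obj b' ⟶ a} {p : b ⟶ t} {p' : b' ⟶ t'}
    (hp : K.toFunctor.IsStronglyCocartesian u p) (e : K.obj t = a) (e' : K.obj t' = a)
    (hp' : K.map p' ≫ eqToHom e' = u') {f : b ⟶ b'} {η : u ⟶ K.map f ≫ u'} {v v' : t ⟶ t'}
    {θ : p ≫ v ⟶ f ≫ p'} {θ' : p ≫ v' ⟶ f ≫ p'} (hv : K.map v ≫ eqToHom e' = eqToHom e)
    (hv' : K.map v' ≫ eqToHom e' = eqToHom e) (hθ : K.map₂ θ ▷ eqToHom e' ≋ η)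
    (hθ' : K.map₂ θ' ▷ eqToHom e' ≋ η) : v = v' ∧ θ ≋ θ' := by
  subst e'
  obtain rfl : K.map p' = u' := (Strict.comp_id _).symm.trans hp'
  have h := (S.isDiscreteFibration b t' (f ≫ p') (η ≫ eqToHom (K.map_comp f p').symm)).unique
    (y₁ := ⟨_, θ⟩) (y₂ := ⟨_, θ'⟩)
    ((isHomLift_mapFunctor_iff θ _).2 ((CellEq.whiskerRight_id _).symm.trans
      (hθ.trans (CellEq.comp_id (.eqToHom _)).symm)))
    ((isHomLift_mapFunctor_iff θ' _).2 ((CellEq.whiskerRight_id _).symm.trans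
      (hθ'.trans (CellEq.comp_id (.eqToHom _)).symm)))
  obtain ⟨h₁, h₂⟩ := Sigma.mk.inj h
  obtain rfl : v = v' := @Functor.IsStronglyCocartesian.ext _ _ _ _ K.toFunctor _ _ _ _ u p hp _ _
    (𝟙 _) v v' ((isHomLift_id_iff v e rfl).2 hv) ((isHomLift_id_iff v' e rfl).2 hv') h₁
  exact ⟨rfl, .of_eq (eq_of_heq h₂)⟩

namespace SplitDiscreteTwoOpfibration

variable (S : SplitDiscreteTwoOpfibration K) {b b' b'' : B} {a : A}

/-- The codomain of the chosen lift of `u : K b ⟶ a`. -/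
def target (u : K.obj b ⟶ a) : B :=
  (S.split.lift (e := b) u).1

/-- The chosen opcartesian lift of `u : K b ⟶ a`. -/
def chosen (u : K.obj b ⟶ a) : b ⟶ S.target u :=
  (S.split.lift (e := b) u).2

theorem isStronglyCocartesian_chosen (u : K.obj b ⟶ a) :
    K.toFunctor.IsStronglyCocartesian u (S.chosen u) :=
  S.split.isStronglyCocartesian (e := b) u

theorem isHomLift_chosen (u : K.obj b ⟶ a) : K.toFunctor.IsHomLift u (S.chosen u) :=
  (S.isStronglyCocartesian_chosen u).toIsHomLift

theorem obj_target (u : K.obj b ⟶ a) : K.obj (S.target u) = a :=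
  @IsHomLift.codomain_eq _ _ _ _ K.toFunctor _ _ _ _ u (S.chosen u) (S.isHomLift_chosen u)

/-- The identification of `K (S.target u)` with `a`. -/
def counit (u : K.obj b ⟶ a) : K.obj (S.target u) ⟶ a :=
  eqToHom (S.obj_target u)

theorem map_chosen_comp_counit (u : K.obj b ⟶ a) : K.map (S.chosen u) ≫ S.counit u = u :=
  (isHomLift_iff_map_comp_eqToHom u _ (S.obj_target u)).1 (S.isHomLift_chosen u)

theorem isChosen_chosen (u : K.obj b ⟶ a) : S.split.IsChosen (S.chosen u) :=
  ⟨a, u, rfl⟩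

theorem exists_factor (f : b ⟶ b') {u : K.obj b ⟶ a} {u' : K.obj b' ⟶ a}
    (η : u ⟶ K.map f ≫ u') :
    ∃ (v : S.target u ⟶ S.target u') (θ : S.chosen u ≫ v ⟶ f ≫ S.chosen u'),
      K.map v ≫ S.counit u' = S.counit u ∧ K.map₂ θ ▷ S.counit u' ≋ η :=
  exists_cocartesian_factor S (S.isStronglyCocartesian_chosen u) (S.obj_target u) (S.obj_target u')
    (S.map_chosen_comp_counit u') f η

/-- The factorization of `f`, through the chosen lifts, determined by a 2-cell
`u ⟶ K f ≫ u'`. -/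
noncomputable def factor (f : b ⟶ b') {u : K.obj b ⟶ a} {u' : K.obj b' ⟶ a} (η : u ⟶ K.map f ≫ u') :
    S.target u ⟶ S.target u' :=
  (S.exists_factor f η).choose

theorem map_factor_comp_counit (f : b ⟶ b') {u : K.obj b ⟶ a} {u' : K.obj b' ⟶ a}
    (η : u ⟶ K.map f ≫ u') : K.map (S.factor f η) ≫ S.counit u' = S.counit u :=
  (S.exists_factor f η).choose_spec.choose_spec.1

/-- The lift of a 2-cell `u ⟶ K f ≫ u'`. -/
noncomputable def factorCell (f : b ⟶ b') {u : K.obj b ⟶ a} {u' : K.obj b' ⟶ a}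
    (η : u ⟶ K.map f ≫ u') :
    S.chosen u ≫ S.factor f η ⟶ f ≫ S.chosen u' :=
  (S.exists_factor f η).choose_spec.choose

theorem map₂_factorCell (f : b ⟶ b') {u : K.obj b ⟶ a} {u' : K.obj b' ⟶ a}
    (η : u ⟶ K.map f ≫ u') : K.map₂ (S.factorCell f η) ▷ S.counit u' ≋ η :=
  (S.exists_factor f η).choose_spec.choose_spec.2

/-- The tool for computing `factor`, which is defined by choice: each identity below is proved by
exhibiting a candidate with the right image under `K`. -/
theorem factor_unique {f : b ⟶ b'} {u : K.obj b ⟶ a} {u' : K.obj b' ⟶ a}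
    {η : u ⟶ K.map f ≫ u'} {v : S.target u ⟶ S.target u'}
    {θ : S.chosen u ≫ v ⟶ f ≫ S.chosen u'} (hv : K.map v ≫ S.counit u' = S.counit u)
    (hθ : K.map₂ θ ▷ S.counit u' ≋ η) : S.factor f η = v ∧ S.factorCell f η ≋ θ :=
  cocartesian_factor_unique S (S.isStronglyCocartesian_chosen u) (S.obj_target u)
    (S.obj_target u') (S.map_chosen_comp_counit u') (S.map_factor_comp_counit f η) hv
    (S.map₂_factorCell f η) hθ

theorem factor_id {u : K.obj b ⟶ a} {η : u ⟶ K.map (𝟙 b) ≫ u} (h : η ≋ 𝟙 u) :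
    S.factor (𝟙 b) η = 𝟙 _ ∧ S.factorCell (𝟙 b) η ≋ 𝟙 (S.chosen u) := by
  have e : S.chosen u ≫ 𝟙 _ = 𝟙 b ≫ S.chosen u :=
    (Strict.comp_id _).trans (Strict.id_comp _).symm
  have hu : K.map (S.chosen u ≫ 𝟙 _) ≫ S.counit u = u := by
    rw [Strict.comp_id, map_chosen_comp_counit]
  have := S.factor_unique (f := 𝟙 b) (η := η) (v := 𝟙 _) (θ := eqToHom e)
    (map_id_comp K _) ((CellEq.id_whiskerRight (.map₂_id K ((CellEq.eqToHom e))) _).trans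
      (CellEq.trans (.id hu) h.symm))
  exact ⟨this.1, this.2.trans ((CellEq.eqToHom e).trans (.id (Strict.comp_id _)))⟩

/-- Pasting the two factorization squares side by side gives a valid candidate for the composite. -/
theorem factor_comp (f : b ⟶ b') (g : b' ⟶ b'') {u : K.obj b ⟶ a} {u' : K.obj b' ⟶ a}
    {u'' : K.obj b'' ⟶ a} (η : u ⟶ K.map f ≫ u') (ζ : u' ⟶ K.map g ≫ u'')
    {ξ : u ⟶ K.map (f ≫ g) ≫ u''} (h : ξ ≋ η ≫ K.map f ◁ ζ) :
    S.factor (f ≫ g) ξ = S.factor f η ≫ S.factor g ζ ∧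
      S.factorCell (f ≫ g) ξ ≋ S.factorCell f η ▷ S.factor g ζ ≫ (α_ _ _ _).hom ≫
        f ◁ S.factorCell g ζ := by
  have := S.factor_unique (f := f ≫ g) (η := ξ) (v := S.factor f η ≫ S.factor g ζ)
    (θ := (α_ _ _ _).inv ≫ S.factorCell f η ▷ S.factor g ζ ≫ (α_ _ _ _).hom ≫
        f ◁ S.factorCell g ζ ≫ (α_ _ _ _).inv) ?_ ?_
  · refine ⟨this.1, this.2.trans ((CellEq.id_comp (.associator_inv _ _ _)).trans ?_)⟩
    exact .comp (.refl _) (.comp (.refl _) (.comp_id (.associator_inv _ _ _)))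
  · rw [map_comp_comp, map_factor_comp_counit, map_factor_comp_counit]
  · refine CellEq.trans ?_ h.symm
    simp only [K.map₂_comp, comp_whiskerRight]
    refine (CellEq.id_comp (.id_whiskerRight (.map₂_id K (.associator_inv _ _ _)) _)).trans ?_
    refine CellEq.comp_comp ?_ (.id_whiskerRight (.map₂_id K (.associator_hom _ _ _)) _)
      ((CellEq.comp_id (.id_whiskerRight (.map₂_id K (.associator_inv _ _ _)) _)).trans ?_)
    · refine (CellEq.whiskerRight (.map₂_whiskerRight K _ _) rfl).trans ?_
      refine (CellEq.whiskerRight_comp _ _ _).symm.trans ?_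
      exact (CellEq.whiskerRight (.refl _) (S.map_factor_comp_counit g ζ)).trans
        (S.map₂_factorCell f η)
    · refine (CellEq.whiskerRight (.map₂_whiskerLeft K _ _) rfl).trans ?_
      exact (CellEq.whisker_assoc _ _ _).trans (.whiskerLeft rfl (S.map₂_factorCell g ζ))

theorem factor_cell {f f' : b ⟶ b'} (κ : f ⟶ f') {u : K.obj b ⟶ a} {u' : K.obj b' ⟶ a}
    (η : u ⟶ K.map f ≫ u') :
    S.factor f' (η ≫ K.map₂ κ ▷ u') = S.factor f η ∧
      S.factorCell f' (η ≫ K.map₂ κ ▷ u') ≋ S.factorCell f η ≫ κ ▷ S.chosen u' := by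
  refine S.factor_unique (S.map_factor_comp_counit f η) ?_
  rw [K.map₂_comp, comp_whiskerRight]
  refine .comp (S.map₂_factorCell f η) ?_
  refine (CellEq.whiskerRight (.map₂_whiskerRight K _ _) rfl).trans ?_
  exact (CellEq.whiskerRight_comp _ _ _).symm.trans
    (.whiskerRight (.refl _) (S.map_chosen_comp_counit _))

/-- The chosen lift of an identification is an identity. -/
theorem isIdentity_chosen (h : K.obj b = a) :
    ∃ e : b = S.target (eqToHom h), S.chosen (eqToHom h) = eqToHom e := by
  subst h
  have := S.split.lift_id b
  have h₁ : S.target (𝟙 (K.obj b)) = b := congrArg Sigma.fst this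
  refine ⟨h₁.symm, ?_⟩
  have h₂ : HEq (S.chosen (𝟙 (K.obj b))) (𝟙 b) := by
    have := (Sigma.mk.inj_iff.1 this).2
    exact this
  have : ∀ {t : B} (p : b ⟶ t) (e : b = t), HEq p (𝟙 b) → p = eqToHom e := by
    rintro t p rfl h
    exact eq_of_heq h
  exact this _ _ h₂

end SplitDiscreteTwoOpfibration

end

/-! ### Reflection of slice cocones into the marked ones -/

section
variable {B : Type u₁} [Bicategory.{w₁, v₁} B] [Strict B]
  {A : Type u₂} [Bicategory.{w, v} A] [Strict A]
  {C : Type u} [Bicategory.{w, v} C] [Strict C]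
  {K : StrictPseudofunctor B A} {F : StrictPseudofunctor B C} {a : A} {c : C}

namespace SliceCocone

/-- The image under `F` of a 2-cell filling a square. -/
def squareCell (F : StrictPseudofunctor B C) {b b' t t' : B} {p : b ⟶ t} {v : t ⟶ t'} {f : b ⟶ b'}
    {p' : b' ⟶ t'} (θ : p ≫ v ⟶ f ≫ p') : F.map p ≫ F.map v ⟶ F.map f ≫ F.map p' :=
  (F.mapComp p v).inv ≫ F.map₂ θ ≫ (F.mapComp f p').hom

theorem squareCell_cellEq (F : StrictPseudofunctor B C) {b b' t t' : B} {p : b ⟶ t} {v : t ⟶ t'}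
    {f : b ⟶ b'} {p' : b' ⟶ t'} (θ : p ≫ v ⟶ f ≫ p') : squareCell F θ ≋ F.map₂ θ :=
  (CellEq.id_comp (.mapComp_inv _ _ _)).trans (.comp_id (.mapComp_hom _ _ _))

variable (S : SplitDiscreteTwoOpfibration K)

theorem map_factor_congr (W : SliceCocone K F a c) {t t' : B} {v v' : t ⟶ t'} (hv : v = v')
    {e : K.obj t ⟶ a} {e' : K.obj t' ⟶ a} {η : e ⟶ K.map v ≫ e'} {η' : e ⟶ K.map v' ≫ e'}
    (h : η ≋ 𝟙 e) (h' : η' ≋ 𝟙 e) : W.map v η ≋ W.map v' η' :=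
  W.map_congr hv rfl (h.trans h'.symm)

/-- The reflection of a slice cocone into the cartesian-marked ones: it is determined by the values
of the slice cocone on the fibre over `a`. -/
noncomputable def reflect (W : SliceCocone K F a c) : SliceCocone K F a c where
  obj u := F.map (S.chosen u) ≫ W.obj (S.counit u)
  map {_ _} f {u u'} η :=
    F.map (S.chosen u) ◁ W.map (S.factor f η) (eqToHom (S.map_factor_comp_counit f η).symm) ≫
      (α_ _ _ _).inv ≫ squareCell F (S.factorCell f η) ▷ W.obj (S.counit u') ≫ (α_ _ _ _).hom
  map_id {b u η} h := by
    obtain ⟨h₁, h₂⟩ := S.factor_id h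
    refine .comp_eq_id (.whiskerLeft_id _ (W.map_eq_id h₁ rfl (.eqToHom _)))
      (.comp_eq_id (.associator_inv _ _ _) (.comp_eq_id (.id_whiskerRight ?_ _)
        (.associator_hom _ _ _)))
    refine (squareCell_cellEq F _).trans ((CellEq.map₂ F h₂).trans ((CellEq.of_eq
      (F.map₂_id _)).trans (.id ?_)))
    rw [h₁, F.map_id, Strict.comp_id]
  map_comp {b b' b''} f g {u u' u''} η ζ ξ h := by
    obtain ⟨h₁, h₂⟩ := S.factor_comp f g η ζ h
    -- The composition axiom splits: `h₁` handles the cells of `W` along the factorizations, and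
    -- `h₂` the images under `F` of the lifted squares.
    rw [whisker_square_comp]
    refine CellEq.comp (.whiskerLeft rfl (W.map_of_eq_comp h₁ _ _ ?_)) ?_
    · exact (CellEq.eqToHom _).trans (CellEq.comp_eq_id (.eqToHom _)
        (.whiskerLeft_id _ (.eqToHom _))).symm
    refine (CellEq.id_comp (.associator_inv _ _ _)).trans ?_
    refine CellEq.trans ?_ (CellEq.id_comp (.comp_eq_id
      (.whiskerLeft_id _ (.associator_inv _ _ _)) (.comp_eq_id (.associator_inv _ _ _)
        (.id_whiskerRight (.associator_inv _ _ _) _)))).symm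
    refine (CellEq.comp_id (.associator_hom _ _ _)).trans ((CellEq.whiskerRight ?_ rfl).trans
      (CellEq.comp_id (.comp_eq_id (.associator_hom _ _ _)
        (.whiskerLeft_id _ (.associator_hom _ _ _)))).symm)
    refine (squareCell_cellEq F _).trans ((CellEq.map₂ F h₂).trans ?_)
    simp only [F.map₂_comp]
    refine .comp ?_ (.comp ?_ ?_)
    · exact (CellEq.map₂_whiskerRight F _ _).trans
        (.whiskerRight (squareCell_cellEq F _).symm rfl)
    · refine (CellEq.map₂_id F (.associator_hom _ _ _)).trans
        (CellEq.trans (.id ?_) (CellEq.associator_hom _ _ _).symm)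
      rw [F.map_comp, F.map_comp]
    · exact (CellEq.map₂_whiskerLeft F _ _).trans
        (.whiskerLeft rfl (squareCell_cellEq F _).symm)
  map_cell {b b' f f'} κ {u u'} η := by
    obtain ⟨h₁, h₂⟩ := S.factor_cell κ η
    simp only [Category.assoc, ← associator_naturality_left]
    rw [← comp_whiskerRight_assoc]
    refine CellEq.eq (.comp (.whiskerLeft rfl (W.map_factor_congr h₁.symm (.eqToHom _)
      (.eqToHom _))) ?_)
    refine (CellEq.id_comp (.associator_inv _ _ _)).trans ((CellEq.comp_id
      (.associator_hom _ _ _)).trans (CellEq.trans ?_ ((CellEq.id_comp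
      (.associator_inv _ _ _)).trans (CellEq.comp_id (.associator_hom _ _ _))).symm))
    refine CellEq.whiskerRight (CellEq.symm ?_) rfl
    refine (squareCell_cellEq F _).trans ((CellEq.map₂ F h₂).trans ?_)
    rw [F.map₂_comp]
    exact .comp (squareCell_cellEq F _).symm (.map₂_whiskerRight F _ _)

/-- Morphisms of slice cocones, corresponding to modifications. -/
def IsHom (V W : SliceCocone K F a c) (τ : ∀ {b : B} (u : K.obj b ⟶ a), V.obj u ⟶ W.obj u) :
    Prop :=
  ∀ {b b' : B} (f : b ⟶ b') {u : K.obj b ⟶ a} {u' : K.obj b' ⟶ a} (η : u ⟶ K.map f ≫ u'),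
    V.map f η ≫ F.map f ◁ τ u' = τ u ≫ W.map f η

theorem IsHom.map_cellEq {V W : SliceCocone K F a c}
    {τ : ∀ {b : B} (u : K.obj b ⟶ a), V.obj u ⟶ W.obj u} (h : IsHom V W τ) {b b' : B}
    (f : b ⟶ b') {u : K.obj b ⟶ a} {u' : K.obj b' ⟶ a} (η : u ⟶ K.map f ≫ u')
    (hu : τ u ≋ 𝟙 (V.obj u)) (hu' : τ u' ≋ 𝟙 (V.obj u')) : V.map f η ≋ W.map f η :=
  (CellEq.comp_id (.whiskerLeft_id _ hu')).symm.trans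
    ((CellEq.of_eq (h f η)).trans (.id_comp hu))

/-- This is how equalities of cocones arise: a morphism all of whose components are identities
forces source and target to coincide. It is what yields an isomorphism of categories instead of an
equivalence. -/
theorem IsHom.eq {V W : SliceCocone K F a c}
    {τ : ∀ {b : B} (u : K.obj b ⟶ a), V.obj u ⟶ W.obj u} (h : IsHom V W τ)
    (hτ : ∀ {b : B} (u : K.obj b ⟶ a), τ u ≋ 𝟙 (V.obj u)) : V = W :=
  ext_of_cellEq (fun u => (hτ u).cod.symm) (fun f _ _ η => h.map_cellEq f η (hτ _) (hτ _))

theorem IsHom.comp {V W X : SliceCocone K F a c}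
    {τ : ∀ {b : B} (u : K.obj b ⟶ a), V.obj u ⟶ W.obj u} (h : IsHom V W τ)
    {σ : ∀ {b : B} (u : K.obj b ⟶ a), W.obj u ⟶ X.obj u} (h' : IsHom W X σ) :
    IsHom V X (fun u => τ u ≫ σ u) := by
  intro b b' f u u' η
  rw [Bicategory.whiskerLeft_comp, ← Category.assoc, h, Category.assoc, h', Category.assoc]

/-- The comparison of a slice cocone with its reflection. -/
def unit (W : SliceCocone K F a c) {b : B} (u : K.obj b ⟶ a) :
    W.obj u ⟶ F.map (S.chosen u) ≫ W.obj (S.counit u) :=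
  W.map (S.chosen u) (eqToHom (S.map_chosen_comp_counit u).symm)

/-- In the slice, `f` followed by the chosen lift of `u'` and the chosen lift of `u` followed by
`factor` are connected by `factorCell`. Expanding both composites with `map_comp` and comparing them
with `map_cell` gives the square. -/
theorem isHom_unit (W : SliceCocone K F a c) :
    IsHom W (W.reflect S) (fun u => W.unit S u) := by
  intro b b' f u u' η
  have h₁ : eqToHom (S.map_chosen_comp_counit u).symm ≫
      K.map (S.chosen u) ◁ eqToHom (S.map_factor_comp_counit f η).symm ≋ 𝟙 u :=
    .comp_eq_id (.eqToHom _) (.whiskerLeft_id _ (.eqToHom _))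
  have h₂ : u = K.map (S.chosen u ≫ S.factor f η) ≫ S.counit u' := by
    rw [map_comp_comp, S.map_factor_comp_counit, S.map_chosen_comp_counit]
  have h₃ := W.map_comp (S.chosen u) (S.factor f η) _ _ ((CellEq.eqToHom h₂).trans h₁.symm)
  have h₄ : η ≫ K.map f ◁ eqToHom (S.map_chosen_comp_counit u').symm ≋ η :=
    .comp_id (.whiskerLeft_id _ (.eqToHom _))
  have h₅ : eqToHom h₂ ≫ K.map₂ (S.factorCell f η) ▷ S.counit u' ≋ η :=
    (CellEq.id_comp (.eqToHom _)).trans (S.map₂_factorCell f η)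
  have h₆ := W.map_comp f (S.chosen u') _ _ (h₅.trans h₄.symm)
  refine (h₆.symm.trans ?_).eq
  rw [← W.map_cell]
  change _ ≋ W.map _ _ ≫ F.map (S.chosen u) ◁ W.map _ _ ≫ _
  rw [← Category.assoc (W.map _ _) (F.map (S.chosen u) ◁ W.map _ _)]
  refine h₃.comp (CellEq.trans ?_ ((CellEq.id_comp
      (.associator_inv _ _ _)).trans (CellEq.comp_id (.associator_hom _ _ _))).symm)
  exact .whiskerRight (squareCell_cellEq F _).symm rfl

theorem map_eqToHom (W : SliceCocone K F a c) {b t : B} {p : b ⟶ t} (e : b = t) (hp : p = eqToHom e)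
    {u : K.obj b ⟶ a} {x : K.obj t ⟶ a} {η : u ⟶ K.map p ≫ x} (h : η ≋ 𝟙 u) :
    W.map p η ≋ 𝟙 (W.obj u) := by
  subst e
  exact W.map_eq_id hp (((map_id_comp K x).symm.trans (by rw [hp]; rfl)).trans h.cod) h

/-- Over the fibre the chosen lift is an identity, because the splitting preserves identities. -/
theorem unit_eqToHom (W : SliceCocone K F a c) {b : B} (h : K.obj b = a) :
    W.unit S (eqToHom h) ≋ 𝟙 (W.obj (eqToHom h)) := by
  obtain ⟨e, he⟩ := S.isIdentity_chosen h
  exact W.map_eqToHom e he (.eqToHom _)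

/-- A slice cocone is cartesian-marked if it sends the chosen opcartesian morphisms to
identities. -/
def IsMarked (W : SliceCocone K F a c) : Prop :=
  ∀ {b b' : B} (f : b ⟶ b') (_ : S.split.IsChosen f) (u : K.obj b' ⟶ a),
    W.map f (𝟙 (K.map f ≫ u)) ≋ 𝟙 (W.obj (K.map f ≫ u))

variable {S}

theorem IsMarked.unit {W : SliceCocone K F a c} (h : W.IsMarked S) {b : B} (u : K.obj b ⟶ a) :
    W.unit S u ≋ 𝟙 (W.obj u) := by
  have e := S.map_chosen_comp_counit u
  exact (W.map_congr rfl rfl ((CellEq.eqToHom e.symm).trans (.id e.symm))).trans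
    ((h (S.chosen u) (S.isChosen_chosen u) (S.counit u)).trans (.id (congrArg W.obj e)))

/-- The unit is the value of `W` on a chosen lift, hence an identity when `W` is marked. -/
theorem IsMarked.eq_reflect {W : SliceCocone K F a c} (h : W.IsMarked S) : W = W.reflect S :=
  IsHom.eq (W.isHom_unit S) h.unit

/-- The definition of `reflect` evaluates the cocone only at identifications `K b = a`. -/
theorem reflect_congr {V W : SliceCocone K F a c}
    (h : ∀ {b : B} (e : K.obj b = a), V.obj (eqToHom e) = W.obj (eqToHom e))
    (h' : ∀ {b b' : B} (f : b ⟶ b') (e : K.obj b = a) (e' : K.obj b' = a)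
      (η : eqToHom e ⟶ K.map f ≫ eqToHom e'), V.map f η ≋ W.map f η) :
    V.reflect S = W.reflect S := by
  refine ext_of_cellEq (fun u => congrArg _ (h (S.obj_target u))) (fun f u u' η => ?_)
  exact .comp (.whiskerLeft rfl (h' _ (S.obj_target u) (S.obj_target u') _))
    ((CellEq.id_comp (.associator_inv _ _ _)).trans ((CellEq.comp_id
      (.associator_hom _ _ _)).trans (CellEq.trans (.whiskerRight (.refl _)
        (h (S.obj_target u'))) ((CellEq.id_comp (.associator_inv _ _ _)).trans
        (CellEq.comp_id (.associator_hom _ _ _))).symm)))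

/-- A marked `V` equals its own reflection, which depends only on the fibre, where `V` and `W` agree
through `τ`. -/
theorem IsHom.eq_reflect {V W : SliceCocone K F a c}
    {τ : ∀ {b : B} (u : K.obj b ⟶ a), W.obj u ⟶ V.obj u} (h : IsHom W V τ) (hV : V.IsMarked S)
    (hτ : ∀ {b : B} (e : K.obj b = a), τ (eqToHom e) ≋ 𝟙 (W.obj (eqToHom e))) :
    V = W.reflect S :=
  hV.eq_reflect.trans (reflect_congr (fun e => (hτ e).cod)
    (fun f e e' η => (h.map_cellEq f η (hτ e) (hτ e')).symm))

/-- Naturality of `τ` at the chosen lift of `u`: the component of `τ` on the fibre and the value of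
`V` on the chosen lift are both identities, leaving `τ u` on one side and the unit on the other. -/
theorem IsHom.cellEq_unit {V W : SliceCocone K F a c}
    {τ : ∀ {b : B} (u : K.obj b ⟶ a), W.obj u ⟶ V.obj u} (h : IsHom W V τ) (hV : V.IsMarked S)
    (hτ : ∀ {b : B} (e : K.obj b = a), τ (eqToHom e) ≋ 𝟙 (W.obj (eqToHom e))) {b : B}
    (u : K.obj b ⟶ a) : τ u ≋ W.unit S u :=
  (CellEq.comp_id ((hV.unit u).trans (.id (hV.unit u).dom))).symm.trans
    ((CellEq.of_eq (h (S.chosen u) _).symm).trans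
      (.comp_id (.whiskerLeft_id _ (hτ (S.obj_target u)))))

theorem whiskerLeft_square {x x' y y' z : C} {k : y ⟶ y'} {p : x ⟶ x'} {l : x ⟶ y} {l' : x' ⟶ y'}
    {s r : y ⟶ z} {s' r' : y' ⟶ z} (η : s ⟶ k ≫ s') (θ : r ⟶ k ≫ r') (m : l ≫ k ⟶ p ≫ l')
    (τ : s ⟶ r) (τ' : s' ⟶ r') (h : η ≫ k ◁ τ' = τ ≫ θ) :
    (l ◁ η ≫ (α_ _ _ _).inv ≫ m ▷ s' ≫ (α_ _ _ _).hom) ≫ p ◁ l' ◁ τ' =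
      l ◁ τ ≫ l ◁ θ ≫ (α_ _ _ _).inv ≫ m ▷ r' ≫ (α_ _ _ _).hom := by
  rw [← Bicategory.whiskerLeft_comp_assoc, ← h]
  simp only [Category.assoc, ← associator_naturality_right, ← whisker_exchange_assoc,
    Bicategory.whiskerLeft_comp, associator_inv_naturality_right_assoc]

theorem IsHom.reflect {V W : SliceCocone K F a c}
    {τ : ∀ {b : B} (u : K.obj b ⟶ a), W.obj u ⟶ V.obj u} (h : IsHom W V τ) :
    IsHom (W.reflect S) (V.reflect S) (fun u => F.map (S.chosen u) ◁ τ (S.counit u)) :=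
  fun f _ _ η => whiskerLeft_square _ _ _ _ _ (h (S.factor f η) _)

/-- Since `V` is the reflection of `W` on the nose, `ρ` can be taken to be the reflection of `σ`,
followed by the identification of the reflection of the marked cocone `X` with `X`. -/
theorem IsHom.exists_factor {V W X : SliceCocone K F a c}
    {τ : ∀ {b : B} (u : K.obj b ⟶ a), W.obj u ⟶ V.obj u} (h : IsHom W V τ) (hV : V.IsMarked S)
    (hτ : ∀ {b : B} (e : K.obj b = a), τ (eqToHom e) ≋ 𝟙 (W.obj (eqToHom e)))
    {σ : ∀ {b : B} (u : K.obj b ⟶ a), W.obj u ⟶ X.obj u} (h' : IsHom W X σ) (hX : X.IsMarked S) :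
    ∃ ρ : ∀ {b : B} (u : K.obj b ⟶ a), V.obj u ⟶ X.obj u, IsHom V X ρ ∧
      ∀ {b : B} (u : K.obj b ⟶ a), τ u ≫ ρ u = σ u := by
  obtain rfl := h.eq_reflect hV hτ
  refine ⟨fun u => F.map (S.chosen u) ◁ σ (S.counit u) ≫ eqToHom (hX.unit u).cod, ?_, ?_⟩
  · intro b b' f u u' η
    refine CellEq.eq ((CellEq.comp (.refl _) (.whiskerLeft rfl (.comp_id (.eqToHom _)))).trans
      ((CellEq.of_eq (h'.reflect (S := S) f η)).trans
        (.comp (CellEq.comp_id (.eqToHom _)).symm ?_)))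
    exact (IsHom.map_cellEq (X.isHom_unit S) f η (hX.unit u) (hX.unit u')).symm
  · intro b u
    have e := h' (S.chosen u) (eqToHom (S.map_chosen_comp_counit u).symm)
    refine CellEq.eq ((CellEq.comp (h.cellEq_unit hV hτ u) (.comp_id (.eqToHom _))).trans
      ((CellEq.of_eq e).trans ?_))
    exact .comp_id (hX.unit u)

/-- In the naturality square at the chosen lift of `u`, the edge given by the marked target is an
identity, so `τ u` is expressed through the component at the identification over `a`. -/
theorem IsHom.eq_of_fibre {V W : SliceCocone K F a c}
    {τ σ : ∀ {b : B} (u : K.obj b ⟶ a), V.obj u ⟶ W.obj u} (h : IsHom V W τ) (h' : IsHom V W σ)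
    (hW : W.IsMarked S)
    (e : ∀ {b : B} (e : K.obj b = a), τ (eqToHom e) = σ (eqToHom e)) {b : B} (u : K.obj b ⟶ a) :
    τ u = σ u := by
  have h₁ := h (S.chosen u) (eqToHom (S.map_chosen_comp_counit u).symm)
  have h₂ := h' (S.chosen u) (eqToHom (S.map_chosen_comp_counit u).symm)
  have e' : τ (S.counit u) = σ (S.counit u) := e (S.obj_target u)
  dsimp only at h₁ h₂
  rw [e', h₂] at h₁
  exact ((CellEq.comp_id (hW.unit u)).symm.trans ((CellEq.of_eq h₁.symm).trans
    (.comp_id (hW.unit u)))).eq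

/-- Strict compatibility of the splitting with composition, in the form used to show that
reflections are marked. -/
theorem chosen_map_comp (S : SplitDiscreteTwoOpfibration K) {b b' : B} {f : b ⟶ b'}
    (hf : S.split.IsChosen f) (u : K.obj b' ⟶ a) :
    ∃ e : S.target (K.map f ≫ u) = S.target u,
      S.chosen (K.map f ≫ u) ≫ eqToHom e = f ≫ S.chosen u := by
  obtain ⟨d, g, hg⟩ := hf
  -- The second morphism stays universally quantified, since its source depends on `S.split.lift g`,
  -- which is about to be rewritten.
  have h := fun {d' : A} => S.split.lift_comp (d' := d') g
  rw [hg] at h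
  have h := h u
  obtain ⟨h₁, h₂⟩ := Sigma.mk.inj_iff.1 h
  refine ⟨h₁, ?_⟩
  have : ∀ {t t' : B} (p : b ⟶ t) (p' : b ⟶ t') (e : t = t'), HEq p p' → p ≫ eqToHom e = p' := by
    rintro t t' p p' rfl h
    exact (Strict.comp_id p).trans (eq_of_heq h)
  exact this _ _ h₁ h₂

theorem map_eqToHom_comp_eqToHom (K : StrictPseudofunctor B A) {t t' : B} (e : t = t')
    (h' : K.obj t' = a) (h : K.obj t = a) : K.map (eqToHom e) ≫ eqToHom h' = eqToHom h := by
  subst e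
  exact map_id_comp K _

/-- By `chosen_map_comp`, for chosen `f` the factorization square of an identity cell can be filled
by `eqToHom`s, so uniqueness makes both `factor` and `factorCell` identities. -/
theorem isMarked_reflect (S : SplitDiscreteTwoOpfibration K) (W : SliceCocone K F a c) :
    (W.reflect S).IsMarked S := by
  intro b b' f hf u
  obtain ⟨e, he⟩ := chosen_map_comp S hf u
  have hc : K.map (S.chosen (K.map f ≫ u) ≫ eqToHom e) ≫ S.counit u = K.map f ≫ u := by
    rw [he, map_comp_comp, S.map_chosen_comp_counit]
  obtain ⟨h₁, h₂⟩ := S.factor_unique (f := f) (η := 𝟙 (K.map f ≫ u)) (v := eqToHom e)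
    (θ := eqToHom he) (map_eqToHom_comp_eqToHom K e _ _)
    ((CellEq.id_whiskerRight (.map₂_id K (.eqToHom _)) _).trans (.id hc))
  refine .comp_eq_id (.whiskerLeft_id _ (W.map_eqToHom e h₁ (.eqToHom _)))
    (.comp_eq_id (.associator_inv _ _ _) (.comp_eq_id (.id_whiskerRight ?_ _)
      (.associator_hom _ _ _)))
  refine (squareCell_cellEq F _).trans ((CellEq.map₂ F h₂).trans
    ((CellEq.map₂_id F (.eqToHom _)).trans (.id ?_)))
  rw [h₁, F.map_comp]

end SliceCocone

end

/-! ### Isomorphisms of categories as fully faithful functors bijective on objects -/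

section
variable {E : Type u} [Category.{v} E] {D : Type u₁} [Category.{v₁} D] {G : E ⥤ D}

theorem IsIsoOfCategories.isEquivalence (h : IsIsoOfCategories G) : G.IsEquivalence := by
  obtain ⟨H, h₁, h₂⟩ := h
  exact (CategoryTheory.Equivalence.mk G H (eqToIso h₁.symm) (eqToIso h₂)).isEquivalence_functor

theorem IsIsoOfCategories.obj_injective (h : IsIsoOfCategories G) : Function.Injective G.obj := by
  obtain ⟨H, h₁, -⟩ := h
  intro x y e
  exact (Functor.congr_obj h₁ x).symm.trans ((congrArg H.obj e).trans (Functor.congr_obj h₁ y))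

theorem IsIsoOfCategories.obj_surjective (h : IsIsoOfCategories G) : Function.Surjective G.obj := by
  obtain ⟨H, -, h₂⟩ := h
  exact fun y => ⟨H.obj y, Functor.congr_obj h₂ y⟩

theorem isIsoOfCategories_of_bijective [G.Full] [G.Faithful] (h : Function.Bijective G.obj) :
    IsIsoOfCategories G := by
  obtain ⟨h₁, h₂⟩ := h
  choose o ho using h₂
  let H : D ⥤ E :=
    { obj := o
      map := fun {x y} φ => G.preimage (eqToHom (ho x) ≫ φ ≫ eqToHom (ho y).symm)
      map_id := fun x => G.map_injective (by simp)
      map_comp := fun φ ψ => G.map_injective (by simp) }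
  refine ⟨H, CategoryTheory.Functor.ext (fun x => h₁ (ho (G.obj x))) (fun x y f => ?_),
    CategoryTheory.Functor.ext ho (fun x y f => ?_)⟩
  · apply G.map_injective
    simp [H, eqToHom_map]
  · simp [H]

end

/-! ### The pointwise universal property in terms of slice cocones -/

section
variable {B : Type u₁} [Bicategory.{w₁, v₁} B] [Strict B]
  {A : Type u₂} [Bicategory.{w, v} A] [Strict A]
  {C : Type u} [Bicategory.{w, v} C] [Strict C]
  {K : StrictPseudofunctor B A} {F : StrictPseudofunctor B C}

section
variable {a : A} {c : C} (X Y : Lax.OplaxTrans (homInto K a).toLax (homInto F c).toLax)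

/-- The components of an oplax natural transformation `A(K(-), a) ⇒ C(F(-), c)`. -/
def oplaxApp (b : B) : (K.obj b ⟶ a) ⥤ (F.obj b ⟶ c) :=
  (X.app (op b)).toFunctor

/-- The structure 2-cells of an oplax natural transformation `A(K(-), a) ⇒ C(F(-), c)`. -/
def oplaxNat {b b' : B} (f : b ⟶ b') (u : K.obj b' ⟶ a) :
    (oplaxApp X b).obj (K.map f ≫ u) ⟶ F.map f ≫ (oplaxApp X b').obj u :=
  (X.naturality f.op).toNatTrans.app u

theorem oplaxNat_id {b : B} (u : K.obj b ⟶ a) :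
    oplaxNat X (𝟙 b) u ≋ 𝟙 ((oplaxApp X b).obj u) := by
  have e := congrArg (fun η => η.toNatTrans.app u) (X.naturality_id (op b))
  have e₁ := homInto_mapId_app K a b u
  have e₂ := homInto_mapId_app F c b ((oplaxApp X b).obj u)
  have h : (oplaxApp X b).map (((homInto K a).toLax.mapId (op b)).toNatTrans.app u) ≫
      oplaxNat X (𝟙 b) u = 𝟙 _ ≫ 𝟙 _ ≫
        ((homInto F c).toLax.mapId (op b)).toNatTrans.app ((oplaxApp X b).obj u) := e
  have h₁ : (oplaxApp X b).map (((homInto K a).toLax.mapId (op b)).toNatTrans.app u) ≋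
      𝟙 ((oplaxApp X b).obj u) :=
    (CellEq.map _ ((CellEq.of_eq e₁).trans (.eqToHom _))).trans
      (.of_eq ((oplaxApp X b).map_id u))
  refine (CellEq.id_comp h₁).symm.trans ((CellEq.of_eq h).trans ?_)
  refine (CellEq.id_comp (.refl _)).trans ((CellEq.id_comp (.refl _)).trans ?_)
  exact (CellEq.of_eq e₂).trans (.eqToHom _)

variable {X Y}

/-- The combined cells determine everything: `f = 𝟙 b` recovers the action on 2-cells, and an
identity `η` recovers the structure 2-cells. -/
theorem oplaxTrans_ext (h : ∀ (b : B) (u : K.obj b ⟶ a),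
      (oplaxApp X b).obj u = (oplaxApp Y b).obj u)
    (h' : ∀ {b b' : B} (f : b ⟶ b') {u : K.obj b ⟶ a} {u' : K.obj b' ⟶ a}
      (η : u ⟶ K.map f ≫ u'), (oplaxApp X b).map η ≫ oplaxNat X f u' ≋
        (oplaxApp Y b).map η ≫ oplaxNat Y f u') : X = Y := by
  have h₁ : ∀ {b : B} {u v : K.obj b ⟶ a} (η : u ⟶ v),
      (oplaxApp X b).map η ≋ (oplaxApp Y b).map η := by
    intro b u v η
    have e := h' (𝟙 b) (η ≫ eqToHom (map_id_comp K v).symm)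
    have e' : η ≫ eqToHom (map_id_comp K v).symm ≋ η := .comp_id (.eqToHom _)
    refine (CellEq.map _ e').symm.trans (CellEq.trans ?_ (e.trans (CellEq.trans ?_
      (CellEq.map _ e'))))
    · exact (CellEq.comp_id ((oplaxNat_id X v).trans (.id (oplaxNat_id X v).dom.symm))).symm
    · exact .comp_id ((oplaxNat_id Y v).trans (.id (oplaxNat_id Y v).dom.symm))
  have h₂ : ∀ {b b' : B} (f : b ⟶ b') (u : K.obj b' ⟶ a), oplaxNat X f u ≋ oplaxNat Y f u := by
    intro b b' f u
    refine CellEq.trans ?_ ((h' f (𝟙 (K.map f ≫ u))).trans ?_)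
    · exact (CellEq.id_comp (.of_eq ((oplaxApp X b).map_id _))).symm
    · exact .id_comp (.of_eq ((oplaxApp Y b).map_id _))
  have h₃ : X.app = Y.app := by
    funext b
    ext1
    exact CategoryTheory.Functor.ext (h b.unop) (fun u v η => (h₁ (b := b.unop) η).eq_conj _ _)
  obtain ⟨X₁, X₂, _, _, _⟩ := X
  obtain ⟨Y₁, Y₂, _, _, _⟩ := Y
  dsimp only at h₃
  subst h₃
  obtain rfl : @X₂ = @Y₂ := by
    funext b b' f
    ext u
    exact (h₂ (b := b'.unop) (b' := b.unop) f.unop u).eq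
  rfl

open scoped Lax.OplaxTrans in
/-- A modification from components compatible with structure 2-cells. -/
def mkModification
    (X Y : (homInto K a).toLax ⟶ (homInto F c).toLax)
    (τ : ∀ {b : B} (u : K.obj b ⟶ a), (oplaxApp X b).obj u ⟶ (oplaxApp Y b).obj u)
    (h : ∀ {b b' : B} (f : b ⟶ b') {u : K.obj b ⟶ a} {u' : K.obj b' ⟶ a}
      (η : u ⟶ K.map f ≫ u'), ((oplaxApp X b).map η ≫ oplaxNat X f u') ≫ F.map f ◁ τ u' =
        τ u ≫ (oplaxApp Y b).map η ≫ oplaxNat Y f u') : X ⟶ Y where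
  as :=
    { app := fun b => NatTrans.toCatHom₂ (C := Cat.of (K.obj b.unop ⟶ a))
        (D := Cat.of (F.obj b.unop ⟶ c))
        { app := fun u => τ u
          naturality := fun u v η => by
            -- Naturality in 2-cells is the case of an identity 1-cell of `B`; the modification
            -- axiom below is the case of an identity `η`.
            have e := h (𝟙 b.unop) (η ≫ eqToHom (map_id_comp K v).symm)
            have e' : η ≫ eqToHom (map_id_comp K v).symm ≋ η := .comp_id (.eqToHom _)
            have h₁ := oplaxNat_id X v
            have h₂ := oplaxNat_id Y v
            refine CellEq.eq (CellEq.trans (.comp (CellEq.trans (CellEq.map _ e').symm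
              (CellEq.comp_id (h₁.trans (.id h₁.dom.symm))).symm)
              (CellEq.map_id_whiskerLeft F (τ v)).symm) ((CellEq.of_eq e).trans ?_))
            exact .comp (.refl _) ((CellEq.comp_id (h₂.trans (.id h₂.dom.symm))).trans
              (CellEq.map _ e')) }
      naturality := fun {b' b} f => by
        ext u
        have e := h f.unop (𝟙 (K.map f.unop ≫ u))
        rw [CategoryTheory.Functor.map_id, CategoryTheory.Functor.map_id, Category.id_comp,
          Category.id_comp] at e
        exact e.symm }

end

theorem SliceCocone.isHom_whiskerLeft {a : A} {c d : C} (W : SliceCocone K F a c) {g g' : c ⟶ d}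
    (γ : g ⟶ g') : IsHom (W.postcomp g) (W.postcomp g') (fun u => W.obj u ◁ γ) := by
  intro b b' f u u' η
  change (W.map f η ▷ g ≫ (α_ _ _ _).hom) ≫ F.map f ◁ W.obj u' ◁ γ =
    W.obj u ◁ γ ≫ W.map f η ▷ g' ≫ (α_ _ _ _).hom
  rw [Category.assoc, ← associator_naturality_right, whisker_exchange_assoc]

section
variable (S : SplitDiscreteTwoOpfibration K) {L : StrictPseudofunctor A C}
  {l : Lax.LaxTrans F.toLax (K.comp L).toLax} {a : A} {c : C}

theorem oplaxNat_cocylinder {b b' : B} (f : b ⟶ b') (u : K.obj b' ⟶ a) :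
    oplaxNat (cocylinder l a) f u = laxApp l b ◁ (L.mapComp (K.map f) u).hom ≫ (α_ _ _ _).inv ≫
      laxNat l f ▷ L.map u ≫ (α_ _ _ _).hom := by
  -- The identities are the components of the associators of `Cat` in the vertical composite.
  change 𝟙 _ ≫ laxApp l b ◁ (L.mapComp (K.map f) u).hom ≫ 𝟙 _ ≫
    ((α_ (laxApp l b) (L.map (K.map f)) (L.map u)).inv ≫ laxNat l f ▷ L.map u ≫
      (α_ (F.map f) (laxApp l b') (L.map u)).hom) ≫ 𝟙 _ = _
  rw [Category.id_comp]
  refine congrArg _ ((Category.id_comp _).trans (Category.comp_id _))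

open scoped Lax.OplaxTrans in
theorem oplaxNat_comparison (g : L.obj a ⟶ c) {b b' : B} (f : b ⟶ b') (u : K.obj b' ⟶ a) :
    oplaxNat (cocylinder l a ≫ homPostcomp F g) f u = oplaxNat (cocylinder l a) f u ▷ g ≫
      (α_ (F.map f) (laxApp l b' ≫ L.map u) g).hom := by
  change 𝟙 _ ≫ oplaxNat (cocylinder l a) f u ▷ g ≫ 𝟙 _ ≫
      (α_ (F.map f) (laxApp l b' ≫ L.map u) g).hom ≫ 𝟙 _ = _
  rw [Category.id_comp]
  refine congrArg _ ((Category.id_comp _).trans (Category.comp_id _))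

theorem whiskerRight_comp_aux {x y z t : C} (k : x ⟶ y) {s s' r : y ⟶ z} (η : s ⟶ s') (θ : s' ⟶ r)
    {q : x ⟶ z} (κ : k ≫ r ⟶ q) (g : z ⟶ t) {p : x ⟶ t} (σ : q ≫ g ⟶ p) :
    (k ◁ η) ▷ g ≫ (k ◁ θ ≫ κ) ▷ g ≫ σ = (k ◁ (η ≫ θ) ≫ κ) ▷ g ≫ σ := by
  simp only [Bicategory.whiskerLeft_comp, comp_whiskerRight, Category.assoc]

open scoped Lax.OplaxTrans in
-- The bridge to the hypothesis: `comparison` sends `g` to the transformation presented by the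
-- cocone of `l` postcomposed with `g`.
theorem oplaxMap_comparison (g : L.obj a ⟶ c) {b b' : B} (f : b ⟶ b') {u : K.obj b ⟶ a}
    {u' : K.obj b' ⟶ a} (η : u ⟶ K.map f ≫ u') :
    (oplaxApp (cocylinder l a ≫ homPostcomp F g) b).map η ≫
      oplaxNat (cocylinder l a ≫ homPostcomp F g) f u' = ((hat l a).postcomp g).map f η := by
  rw [oplaxNat_comparison, oplaxNat_cocylinder]
  exact whiskerRight_comp_aux _ _ _ _ _ _

theorem oplaxMap_toOplax (W : SliceCocone K F a c) {b b' : B} (f : b ⟶ b') {u : K.obj b ⟶ a}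
    {u' : K.obj b' ⟶ a} (η : u ⟶ K.map f ≫ u') :
    (oplaxApp W.toOplax b).map η ≫ oplaxNat W.toOplax f u' = W.map f η :=
  (W.cell_comp_map f η (𝟙 _)).trans (congrArg _ (Category.comp_id η))

variable {S}

theorem SliceCocone.IsMarked.toOplax {W : SliceCocone K F a c} (h : W.IsMarked S) :
    IsCartesianMarkedOplax S (V := homInto K a) (W := homInto F c) W.toOplax :=
  fun _ _ f hf => isIdentityCell_cat _ fun u => (h f hf u).isIdentityCell

theorem isMarked_hat (hl : IsCartesianMarkedLax S l) (g : L.obj a ⟶ c) :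
    ((hat l a).postcomp g).IsMarked S := by
  intro b b' f hf u
  refine ((hat l a).postcomp_map g f _).trans (.id_whiskerRight ?_ g)
  refine .comp_eq_id (.whiskerLeft_id _ (.comp_eq_id (.map₂_id L (.refl _))
    (.mapComp_hom _ _ _))) (.comp_eq_id (.associator_inv _ _ _) (.comp_eq_id
      (.id_whiskerRight (IsIdentityCell.cellEq ?_) _) (.associator_hom _ _ _)))
  exact hl f hf

variable {hl : IsCartesianMarkedLax S l}

open scoped Lax.OplaxTrans in
-- Surjectivity of `comparison` on objects. The next three results extract injectivity on objects,
-- fullness and faithfulness in the same language.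
theorem exists_hat_postcomp_eq (h : IsIsoOfCategories (comparison S hl a c))
    {W : SliceCocone K F a c} (hW : W.IsMarked S) : ∃ g, (hat l a).postcomp g = W := by
  obtain ⟨g, hg⟩ := h.obj_surjective ⟨W.toOplax, hW.toOplax⟩
  have hg := congrArg (fun X => X.obj) hg
  have e : ∀ {X Y : Lax.OplaxTrans (homInto K a).toLax (homInto F c).toLax}, X = Y →
      ∀ {b b' : B} (f : b ⟶ b') {u : K.obj b ⟶ a} {u' : K.obj b' ⟶ a} (η : u ⟶ K.map f ≫ u'),
      (oplaxApp X b).map η ≫ oplaxNat X f u' ≋ (oplaxApp Y b).map η ≫ oplaxNat Y f u' := by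
    rintro X _ rfl
    exact fun _ _ _ _ => .refl _
  refine ⟨g, SliceCocone.ext_of_cellEq (fun {b} u => congrArg (fun X => (oplaxApp X b).obj u) hg)
    (fun f u u' η => ?_)⟩
  rw [← oplaxMap_comparison, ← oplaxMap_toOplax]
  exact e hg f η

open scoped Lax.OplaxTrans in
theorem hat_postcomp_injective (h : IsIsoOfCategories (comparison S hl a c)) {g g' : L.obj a ⟶ c}
    (e : (hat l a).postcomp g = (hat l a).postcomp g') : g = g' := by
  have e' : ∀ {V W : SliceCocone K F a c}, V = W → (∀ {b : B} (u : K.obj b ⟶ a),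
      V.obj u = W.obj u) ∧ ∀ {b b' : B} (f : b ⟶ b') {u : K.obj b ⟶ a} {u' : K.obj b' ⟶ a}
      (η : u ⟶ K.map f ≫ u'), V.map f η ≋ W.map f η := by
    rintro X _ rfl
    exact ⟨fun _ => rfl, fun _ _ _ _ => .refl _⟩
  obtain ⟨h₁, h₂⟩ := e' e
  refine h.obj_injective (ObjectProperty.FullSubcategory.ext (oplaxTrans_ext (fun b u => h₁ u) ?_))
  intro b b' f u u' η
  refine (CellEq.of_eq (oplaxMap_comparison g f η)).trans ((h₂ f η).trans (.of_eq ?_))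
  exact (oplaxMap_comparison g' f η).symm

open scoped Lax.OplaxTrans in
theorem exists_whiskerLeft_eq (h : IsIsoOfCategories (comparison S hl a c)) {g g' : L.obj a ⟶ c}
    {τ : ∀ {b : B} (u : K.obj b ⟶ a), (laxApp l b ≫ L.map u) ≫ g ⟶ (laxApp l b ≫ L.map u) ≫ g'}
    (hτ : SliceCocone.IsHom ((hat l a).postcomp g) ((hat l a).postcomp g') τ) :
    ∃ γ : g ⟶ g', ∀ {b : B} (u : K.obj b ⟶ a), (laxApp l b ≫ L.map u) ◁ γ = τ u := by
  have := h.isEquivalence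
  let m := mkModification ((comparison S hl a c).obj g).obj ((comparison S hl a c).obj g').obj τ
    (fun {b b'} f {u u'} η => by
      have h₁ := oplaxMap_comparison (l := l) g f η
      have h₂ := oplaxMap_comparison (l := l) g' f η
      exact (congrArg (· ≫ _) h₁).trans ((hτ f η).trans (congrArg (_ ≫ ·) h₂.symm)))
  obtain ⟨γ, hγ⟩ := (comparison S hl a c).map_surjective (ObjectProperty.homMk m)
  refine ⟨γ, fun {b} u => ?_⟩
  exact congrArg (fun m => (m.hom.as.app (op b)).toNatTrans.app u) hγ

open scoped Lax.OplaxTrans in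
-- Testing on the fibre suffices because the target cocone is marked; faithfulness of `comparison`
-- does the rest.
theorem whiskerLeft_injective (h : IsIsoOfCategories (comparison S hl a c)) {g g' : L.obj a ⟶ c}
    {γ δ : g ⟶ g'} (e : ∀ {b : B} (h : K.obj b = a),
      (laxApp l b ≫ L.map (eqToHom h)) ◁ γ = (laxApp l b ≫ L.map (eqToHom h)) ◁ δ) : γ = δ := by
  have := h.isEquivalence
  have e' {b : B} (u : K.obj b ⟶ a) := SliceCocone.IsHom.eq_of_fibre ((hat l a).isHom_whiskerLeft γ)
    ((hat l a).isHom_whiskerLeft δ) (isMarked_hat hl g') e u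
  apply (comparison S hl a c).map_injective
  ext b u
  exact e' u

end

end

/-! ### Representing 1-cells and their universal property -/

section
variable {B : Type u₁} [Bicategory.{w₁, v₁} B] [Strict B]
  {A : Type u₂} [Bicategory.{w, v} A] [Strict A]
  {C : Type u} [Bicategory.{w, v} C] [Strict C]
  {K : StrictPseudofunctor B A} {F : StrictPseudofunctor B C} {L : StrictPseudofunctor A C}

/-- `g : L a ⟶ c` represents the reflection of the slice cocone `W`. -/
structure Representation (l : Lax.LaxTrans F.toLax (K.comp L).toLax) {a : A} {c : C}
    (W : SliceCocone K F a c) (g : L.obj a ⟶ c) where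
  cell : ∀ {b : B} (u : K.obj b ⟶ a), W.obj u ⟶ (laxApp l b ≫ L.map u) ≫ g
  isHom : SliceCocone.IsHom W ((hat l a).postcomp g) cell
  cell_eqToHom : ∀ {b : B} (e : K.obj b = a), cell (eqToHom e) ≋ 𝟙 (W.obj (eqToHom e))

namespace Representation

variable {S : SplitDiscreteTwoOpfibration K} {l : Lax.LaxTrans F.toLax (K.comp L).toLax}
  {hl : IsCartesianMarkedLax S l} {a : A} {c : C} {W : SliceCocone K F a c}

theorem cell_congr {g : L.obj a ⟶ c} (R : Representation l W g) {b : B} {u u' : K.obj b ⟶ a}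
    (h : u = u') : R.cell u ≋ R.cell u' := by
  subst h
  exact .refl _

/-- The reflection of `W` is marked, hence represented by some `g`; the unit of the reflection
becomes the comparison cell. -/
theorem exists_representation (h : IsIsoOfCategories (comparison S hl a c))
    (W : SliceCocone K F a c) : ∃ g, Nonempty (Representation l W g) := by
  obtain ⟨g, hg⟩ := exists_hat_postcomp_eq h (SliceCocone.isMarked_reflect S W)
  have : ∀ {V : SliceCocone K F a c}, V = W.reflect S →
      ∃ τ : ∀ {b : B} (u : K.obj b ⟶ a), W.obj u ⟶ V.obj u, SliceCocone.IsHom W V τ ∧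
        ∀ {b : B} (e : K.obj b = a), τ (eqToHom e) ≋ 𝟙 (W.obj (eqToHom e)) := by
    rintro _ rfl
    exact ⟨_, W.isHom_unit S, W.unit_eqToHom S⟩
  obtain ⟨τ, h₁, h₂⟩ := this hg
  exact ⟨g, ⟨⟨τ, h₁, h₂⟩⟩⟩

/-- Both represented cocones are equal to the reflection of `W`. -/
theorem eq (h : IsIsoOfCategories (comparison S hl a c)) {g g' : L.obj a ⟶ c}
    (R : Representation l W g) (R' : Representation l W g') : g = g' :=
  hat_postcomp_injective h
    ((SliceCocone.IsHom.eq_reflect R.isHom (isMarked_hat hl g) R.cell_eqToHom).trans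
      (SliceCocone.IsHom.eq_reflect R'.isHom (isMarked_hat hl g') R'.cell_eqToHom).symm)

theorem cell_unique (hl : IsCartesianMarkedLax S l) {g g' : L.obj a ⟶ c}
    (R : Representation l W g) (R' : Representation l W g') {b : B} (u : K.obj b ⟶ a) :
    R.cell u ≋ R'.cell u :=
  (SliceCocone.IsHom.cellEq_unit R.isHom (isMarked_hat hl g) R.cell_eqToHom u).trans
    (SliceCocone.IsHom.cellEq_unit R'.isHom (isMarked_hat hl g') R'.cell_eqToHom u).symm

/-- The universal property of the reflection gives a morphism between marked cocones, which fullness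
of `comparison` turns into a 2-cell. -/
theorem exists_factor (h : IsIsoOfCategories (comparison S hl a c)) {g g' : L.obj a ⟶ c}
    (R : Representation l W g)
    {σ : ∀ {b : B} (u : K.obj b ⟶ a), W.obj u ⟶ (laxApp l b ≫ L.map u) ≫ g'}
    (hσ : SliceCocone.IsHom W ((hat l a).postcomp g') σ) :
    ∃ γ : g ⟶ g', ∀ {b : B} (u : K.obj b ⟶ a),
      R.cell u ≫ (laxApp l b ≫ L.map u) ◁ γ = σ u := by
  obtain ⟨ρ, h₁, h₂⟩ := SliceCocone.IsHom.exists_factor R.isHom (isMarked_hat hl g)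
    R.cell_eqToHom hσ (isMarked_hat hl g')
  obtain ⟨γ, hγ⟩ := exists_whiskerLeft_eq h h₁
  exact ⟨γ, fun u => (congrArg _ (hγ u)).trans (h₂ u)⟩

theorem postcomp_aux {x y z t : C} {p : x ⟶ y} {s : x ⟶ z} {s' : y ⟶ z} {g : z ⟶ t} {d : C}
    (k : t ⟶ d) {q : x ⟶ t} {q' : y ⟶ t} (M : q ⟶ p ≫ q') (X : q ⟶ s ≫ g) (X' : q' ⟶ s' ≫ g)
    (N : s ⟶ p ≫ s') (h : M ≫ p ◁ X' = X ≫ N ▷ g ≫ (α_ _ _ _).hom) :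
    (M ▷ k ≫ (α_ _ _ _).hom) ≫ p ◁ (X' ▷ k ≫ (α_ _ _ _).hom) =
      (X ▷ k ≫ (α_ _ _ _).hom) ≫ N ▷ (g ≫ k) ≫ (α_ _ _ _).hom := by
  have e := congrArg (· ▷ k) h
  simp only [comp_whiskerRight, whisker_assoc] at e
  have e₂ := e =≫ (α_ p (s' ≫ g) k).hom
  simp only [Category.assoc, Iso.inv_hom_id, Category.comp_id] at e₂
  simp [reassoc_of% e₂]

/-- Postcomposition of a representation with a 1-cell. -/
def postcomp {g : L.obj a ⟶ c} (R : Representation l W g) {d : C} (k : c ⟶ d) :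
    Representation l (W.postcomp k) (g ≫ k) where
  cell u := R.cell u ▷ k ≫ (α_ _ _ _).hom
  isHom {_ _} f {u u'} η :=
    postcomp_aux k (W.map f η) (R.cell u) (R.cell u') ((hat l a).map f η) (R.isHom f η)
  cell_eqToHom e := .comp_eq_id (.id_whiskerRight (R.cell_eqToHom e) k) (.associator_hom _ _ _)

end Representation

section
variable {U : StrictPseudofunctor A C} (ψ : Lax.LaxTrans F.toLax (K.comp U).toLax)

theorem hat_map_id {a : A} {b : B} {u u' : K.obj b ⟶ a} {η : u ⟶ K.map (𝟙 b) ≫ u'} {η' : u ⟶ u'}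
    (h : η ≋ η') : (hat ψ a).map (𝟙 b) η ≋ laxApp ψ b ◁ U.map₂ η' := by
  have e : laxApp ψ b ≫ U.map (K.map (𝟙 b) ≫ u') =
      (laxApp ψ b ≫ U.map (K.map (𝟙 b))) ≫ U.map u' := by
    rw [U.map_comp, Strict.assoc]
  refine (hat_map ψ a _ η e).trans ((CellEq.comp_id (.comp_eq_id (.eqToHom _)
    (.id_whiskerRight ((laxNat_id ψ b).trans (.id (laxNat_id ψ b).dom.symm)) _))).trans ?_)
  exact .whiskerLeft rfl (.map₂ U h)

/-- Evaluation at the identity of `K b'` recovers `ψ` from its slice cocones. -/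
theorem hat_map_of_eq_id {b b' : B} (f : b ⟶ b') {η : K.map f ⟶ K.map f ≫ 𝟙 (K.obj b')}
    (h : η ≋ 𝟙 (K.map f)) : (hat ψ (K.obj b')).map f η ≋ laxNat ψ f := by
  have e : laxApp ψ b ≫ U.map (K.map f ≫ 𝟙 (K.obj b')) =
      (laxApp ψ b ≫ U.map (K.map f)) ≫ U.map (𝟙 (K.obj b')) := by
    rw [U.map_comp, Strict.assoc]
  refine (hat_map ψ _ f η e).trans ((CellEq.id_comp (.whiskerLeft_id _ (.map₂_id U h))).trans
    ((CellEq.id_comp (.eqToHom _)).trans ?_))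
  exact (CellEq.whiskerRight (.refl _) (U.map_id _)).trans (.whiskerRight_id _)

/-- Functoriality of `U`: postcomposing the cocone over `a` with `U f` is reindexing the cocone over
`a'` along `u ↦ u ≫ f`. -/
theorem hat_postcomp_map {a a' : A} (f : a ⟶ a') {b b' : B} (k : b ⟶ b') {u : K.obj b ⟶ a}
    {u' : K.obj b' ⟶ a} (η : u ⟶ K.map k ≫ u') :
    ((hat ψ a).postcomp (U.map f)).map k η ≋
      (hat ψ a').map k (η ▷ f ≫ (α_ (K.map k) u' f).hom) := by
  have e : laxApp ψ b ≫ U.map (K.map k ≫ u') =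
      (laxApp ψ b ≫ U.map (K.map k)) ≫ U.map u' := by
    rw [U.map_comp, Strict.assoc]
  have e' : laxApp ψ b ≫ U.map (K.map k ≫ u' ≫ f) =
      (laxApp ψ b ≫ U.map (K.map k)) ≫ U.map (u' ≫ f) := by
    rw [U.map_comp, Strict.assoc]
  refine ((hat ψ a).postcomp_map _ k η).trans ((CellEq.whiskerRight (hat_map ψ a k η e) rfl).trans
    (CellEq.trans ?_ (hat_map ψ a' k _ e').symm))
  simp only [comp_whiskerRight]
  refine .comp ?_ ((CellEq.id_comp (.id_whiskerRight (.eqToHom _) _)).trans (CellEq.trans ?_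
    (CellEq.id_comp (.eqToHom _)).symm))
  · refine (CellEq.whisker_assoc _ _ _).trans (.whiskerLeft rfl ?_)
    refine (CellEq.map₂_whiskerRight U _ _).symm.trans (.map₂ U ?_)
    exact (CellEq.comp_id (.associator_hom _ _ _)).symm
  · exact (CellEq.whiskerRight_comp _ _ _).symm.trans
      (.whiskerRight (.refl _) (U.map_comp _ _).symm)

theorem hat_postcomp_comp_map {a a' : A} {c : C} (f : a ⟶ a') (g : U.obj a' ⟶ c) {b b' : B}
    (k : b ⟶ b') {u : K.obj b ⟶ a} {u' : K.obj b' ⟶ a} (η : u ⟶ K.map k ≫ u') :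
    ((hat ψ a).postcomp (U.map f ≫ g)).map k η ≋
      ((hat ψ a').postcomp g).map k (η ▷ f ≫ (α_ (K.map k) u' f).hom) :=
  ((hat ψ a).postcomp_map _ k η).trans ((CellEq.whiskerRight_comp _ _ _).trans
    ((CellEq.whiskerRight (((hat ψ a).postcomp_map _ k η).symm.trans (hat_postcomp_map ψ f k η))
      rfl).trans ((hat ψ a').postcomp_map g k _).symm))

end

/-! ### Lax transformations with axioms up to identity cells -/

section
variable {G H : StrictPseudofunctor B C}

theorem laxTrans_ext {X Y : Lax.LaxTrans G.toLax H.toLax} (h : ∀ b, X.app b = Y.app b)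
    (h' : ∀ {b b' : B} (f : b ⟶ b'), X.naturality f ≋ Y.naturality f) : X = Y := by
  obtain ⟨X₁, X₂, _, _, _⟩ := X
  obtain ⟨Y₁, Y₂, _, _, _⟩ := Y
  obtain rfl : X₁ = Y₁ := funext h
  obtain rfl : @X₂ = @Y₂ := by
    funext b b' f
    exact (h' f).eq
  rfl

/-- The components of a lax natural transformation. -/
def compApp (φ : Lax.LaxTrans G.toLax H.toLax) (b : B) : G.obj b ⟶ H.obj b := φ.app b

/-- The structure 2-cells of a lax natural transformation. -/
def compNat (φ : Lax.LaxTrans G.toLax H.toLax) {b b' : B} (f : b ⟶ b') :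
    compApp φ b ≫ H.map f ⟶ G.map f ≫ compApp φ b' := φ.naturality f

theorem compNat_id (φ : Lax.LaxTrans G.toLax H.toLax) (b : B) :
    compNat φ (𝟙 b) ≋ 𝟙 (compApp φ b) := by
  have h : compApp φ b ≫ H.map (𝟙 b) = compApp φ b := by
    rw [H.map_id, Strict.comp_id]
  refine CellEq.trans (CellEq.of_eq (laxTrans_naturality_id φ b ?_))
    ((CellEq.eqToHom _).trans (.id h))
  exact h.trans (map_id_comp G (compApp φ b)).symm

theorem compNat_comp (φ : Lax.LaxTrans G.toLax H.toLax) {b b' b'' : B} (f : b ⟶ b')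
    (g : b' ⟶ b'') :
    compNat φ (f ≫ g) ≋ compNat φ f ▷ H.map g ≫ (α_ _ _ _).hom ≫ G.map f ◁ compNat φ g := by
  have h : compApp φ b ≫ H.map (f ≫ g) = (compApp φ b ≫ H.map f) ≫ H.map g := by
    rw [H.map_comp, Strict.assoc]
  refine CellEq.trans (CellEq.of_eq (laxTrans_naturality_comp φ f g h
    (map_comp_comp G f g (compApp φ b'')).symm)) ?_
  refine (CellEq.id_comp (.eqToHom _)).trans (.comp (.refl _) ?_)
  exact CellEq.comp ((CellEq.eqToHom _).trans (CellEq.associator_hom _ _ _).symm)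
    (.comp_id (.eqToHom _))

theorem compNat_cell (φ : Lax.LaxTrans G.toLax H.toLax) {b b' : B} {f g : b ⟶ b'} (κ : f ⟶ g) :
    compNat φ f ≫ G.map₂ κ ▷ compApp φ b' = compApp φ b ◁ H.map₂ κ ≫ compNat φ g :=
  φ.naturality_naturality κ

/-- Constructor for lax natural transformations, with axioms up to identity 2-cells. -/
def mkLax (app : ∀ b, G.obj b ⟶ H.obj b)
    (nat : ∀ {b b' : B} (f : b ⟶ b'), app b ≫ H.map f ⟶ G.map f ≫ app b')
    (nat_cell : ∀ {b b' : B} {f g : b ⟶ b'} (κ : f ⟶ g),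
      nat f ≫ G.map₂ κ ▷ app b' = app b ◁ H.map₂ κ ≫ nat g)
    (nat_id : ∀ b, nat (𝟙 b) ≋ 𝟙 (app b))
    (nat_comp : ∀ {b b' b'' : B} (f : b ⟶ b') (g : b' ⟶ b''),
      nat (f ≫ g) ≋ nat f ▷ H.map g ≫ (α_ _ _ _).hom ≫ G.map f ◁ nat g) :
    Lax.LaxTrans G.toLax H.toLax where
  app := app
  naturality := nat
  naturality_naturality := nat_cell
  naturality_id b := lax_id_aux' (H.map_id b) (G.map_id b) (toLax_mapId H b) (toLax_mapId G b)
    (fun h => ((nat_id b).trans (.id (nat_id b).dom.symm)).eq_eqToHom h)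
  naturality_comp f g := lax_comp_aux' (H.map_comp f g) (G.map_comp f g) (toLax_mapComp H f g)
    (toLax_mapComp G f g) (fun h₁ h₂ => by
      refine CellEq.eq ((nat_comp f g).trans (CellEq.symm ?_))
      refine (CellEq.id_comp (.eqToHom _)).trans (.comp (.refl _) ?_)
      exact CellEq.comp ((CellEq.eqToHom _).trans (CellEq.associator_hom _ _ _).symm)
        (.comp_id (.eqToHom _)))

end

end

/-! ### Pasting with `l` and the structure cells of an extension -/

section
variable {B : Type u₁} [Bicategory.{w₁, v₁} B] [Strict B]
  {A : Type u₂} [Bicategory.{w, v} A] [Strict A]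
  {C : Type u} [Bicategory.{w, v} C] [Strict C]
  {K : StrictPseudofunctor B A} {F : StrictPseudofunctor B C} {L U : StrictPseudofunctor A C}
  {S : SplitDiscreteTwoOpfibration K} {l : Lax.LaxTrans F.toLax (K.comp L).toLax}
  {hl : IsCartesianMarkedLax S l}

section
open scoped Lax.LaxTrans

/-- Pasting of `l` with a lax natural transformation `L ⇒ U`. -/
def paste (l : Lax.LaxTrans F.toLax (K.comp L).toLax) (φ : Lax.LaxTrans L.toLax U.toLax) :
    Lax.LaxTrans F.toLax (K.comp U).toLax :=
  (pasting (K := K) l U).obj φ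

theorem laxNat_paste (φ : Lax.LaxTrans L.toLax U.toLax) {b b' : B} (f : b ⟶ b') :
    laxNat (paste l φ) f = (α_ (laxApp l b) (compApp φ (K.obj b)) (U.map (K.map f))).hom ≫
      laxApp l b ◁ compNat φ (K.map f) ≫ (α_ _ _ _).inv ≫
        laxNat l f ▷ compApp φ (K.obj b') ≫ (α_ _ _ _).hom :=
  rfl

end

theorem compNat_eqToHom (φ : Lax.LaxTrans L.toLax U.toLax) {a a' : A} (e : a = a') :
    compNat φ (eqToHom e) ≋ 𝟙 (compApp φ a ≫ U.map (eqToHom e)) := by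
  subst e
  exact (compNat_id φ a).trans (.id (compNat_id φ a).dom.symm)

/-- Naturality of `φ` in the 2-cell `η`, followed by its composition axiom for `f ≫ u'`. -/
theorem compNat_factor (φ : Lax.LaxTrans L.toLax U.toLax) {p q a : A} {f : p ⟶ q} {u : p ⟶ a}
    {u' : q ⟶ a} (η : u ⟶ f ≫ u') :
    compNat φ u ≫ (L.map₂ η ≫ (L.mapComp f u').hom) ▷ compApp φ a =
      compApp φ p ◁ (U.map₂ η ≫ (U.mapComp f u').hom) ≫ (α_ _ _ _).inv ≫
        compNat φ f ▷ U.map u' ≫ (α_ _ _ _).hom ≫ L.map f ◁ compNat φ u' ≫ (α_ _ _ _).inv := by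
  have e := compNat_cell φ η =≫ (L.mapComp f u').hom ▷ compApp φ a
  simp only [Category.assoc] at e
  rw [Bicategory.whiskerLeft_comp]
  refine ((congrArg _ (comp_whiskerRight _ _ _)).trans (e.trans (CellEq.eq
    (.comp (.refl _) ?_)))).trans (Category.assoc _ _ _).symm
  refine (CellEq.comp_id (.id_whiskerRight (.mapComp_hom _ _ _) _)).trans
    ((compNat_comp φ f u').trans (CellEq.trans ?_
      (CellEq.id_comp (.whiskerLeft_id _ (.mapComp_hom _ _ _))).symm))
  refine CellEq.trans ?_ (CellEq.id_comp (.associator_inv _ _ _)).symm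
  exact .comp (.refl _) (.comp (.refl _) (CellEq.comp_id (.associator_inv _ _ _)).symm)

theorem paste_aux {x x' p q a p' q' a' : C} {k : x ⟶ x'} {i : x ⟶ p} {i' : x' ⟶ q} {m : p ⟶ q}
    (ν : i ≫ m ⟶ k ≫ i') {u : p ⟶ a} {u' : q ⟶ a} (η : u ⟶ m ≫ u')
    {m₁ : p' ⟶ q'} {u₁ : p' ⟶ a'} {u₁' : q' ⟶ a'} (η₁ : u₁ ⟶ m₁ ≫ u₁') {s : p ⟶ p'} {r : q ⟶ q'}
    {t : a ⟶ a'} (μ : s ≫ m₁ ⟶ m ≫ r) (σ : s ≫ u₁ ⟶ u ≫ t) (σ' : r ≫ u₁' ⟶ u' ≫ t)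
    (h : σ ≫ η ▷ t = s ◁ η₁ ≫ (α_ _ _ _).inv ≫ μ ▷ u₁' ≫ (α_ _ _ _).hom ≫ m ◁ σ' ≫
      (α_ _ _ _).inv) :
    ((i ≫ s) ◁ η₁ ≫ (α_ _ _ _).inv ≫ ((α_ _ _ _).hom ≫ i ◁ μ ≫ (α_ _ _ _).inv ≫
        ν ▷ r ≫ (α_ _ _ _).hom) ▷ u₁' ≫ (α_ _ _ _).hom) ≫
          k ◁ ((α_ _ _ _).hom ≫ i' ◁ σ' ≫ (α_ _ _ _).inv) =
      ((α_ _ _ _).hom ≫ i ◁ σ ≫ (α_ _ _ _).inv) ≫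
        (i ◁ η ≫ (α_ _ _ _).inv ≫ ν ▷ u' ≫ (α_ _ _ _).hom) ▷ t ≫ (α_ _ _ _).hom :=
  calc
    _ = 𝟙 _ ⊗≫ i ◁ (s ◁ η₁ ≫ (α_ _ _ _).inv ≫ μ ▷ u₁') ⊗≫
          (ν ▷ (r ≫ u₁') ≫ (k ≫ i') ◁ σ') ⊗≫ 𝟙 _ := by bicategory
    -- Interchange moves `σ'` in front of `ν`, next to `μ`, where `h` applies.
    _ = 𝟙 _ ⊗≫ i ◁ (s ◁ η₁ ≫ (α_ _ _ _).inv ≫ μ ▷ u₁' ≫ (α_ _ _ _).hom ≫ m ◁ σ' ≫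
          (α_ _ _ _).inv) ⊗≫ ν ▷ (u' ≫ t) ⊗≫ 𝟙 _ := by
      rw [← whisker_exchange]
      bicategory
    _ = _ := by
      rw [← h]
      bicategory

/-- A lax natural transformation `φ : L ⇒ U` represents the slice cocone of its pasting
with `l`. -/
def representationOfLax (l : Lax.LaxTrans F.toLax (K.comp L).toLax)
    (φ : Lax.LaxTrans L.toLax U.toLax) (a : A) :
    Representation l (hat (paste l φ) a) (compApp φ a) where
  cell {b} u := (α_ (laxApp l b) (compApp φ (K.obj b)) (U.map u)).hom ≫
    laxApp l b ◁ compNat φ u ≫ (α_ _ _ _).inv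
  isHom {_ _} f {u u'} η := paste_aux (laxNat l f) (L.map₂ η ≫ (L.mapComp (K.map f) u').hom)
    (U.map₂ η ≫ (U.mapComp (K.map f) u').hom) (compNat φ (K.map f)) (compNat φ u) (compNat φ u')
    (compNat_factor φ η)
  cell_eqToHom e := .comp_eq_id (.associator_hom _ _ _)
    (.comp_eq_id (.whiskerLeft_id _ (compNat_eqToHom φ e)) (.associator_inv _ _ _))

theorem representationOfLax_cell (φ : Lax.LaxTrans L.toLax U.toLax) {a : A} {b : B}
    (u : K.obj b ⟶ a) :
    (representationOfLax l φ a).cell u ≋ laxApp l b ◁ compNat φ u :=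
  (CellEq.id_comp (.associator_hom _ _ _)).trans (.comp_id (.associator_inv _ _ _))

theorem laxApp_comp_map_eqToHom (l : Lax.LaxTrans F.toLax (K.comp L).toLax) (b : B) :
    laxApp l b ≫ L.map (eqToHom (rfl : K.obj b = K.obj b)) = laxApp l b :=
  (congrArg _ (L.map_id (K.obj b))).trans (Strict.comp_id _)

/-- 2-cells out of `L a` are determined by their restrictions along `l`. -/
theorem cell_ext (h : ∀ a c, IsIsoOfCategories (comparison S hl a c)) {a : A} {c : C}
    {g g' : L.obj a ⟶ c} {γ δ : g ⟶ g'}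
    (e : ∀ {b : B} (h : K.obj b = a), (laxApp l b ≫ L.map (eqToHom h)) ◁ γ ≋
      (laxApp l b ≫ L.map (eqToHom h)) ◁ δ) : γ = δ :=
  whiskerLeft_injective (h a c) (fun h => (e h).eq)

section extension
variable {ψ : Lax.LaxTrans F.toLax (K.comp U).toLax} {g : ∀ a, L.obj a ⟶ U.obj a}
  (R : ∀ a, Representation l (hat ψ a) (g a))

/-- The comparison cells of `R a'`, reindexed along `f`, form a morphism out of the cocone
represented by `g a ≫ U.map f`. This is the input from which the structure cell at `f` is produced.
-/
theorem isHom_cell_comp {a a' : A} (f : a ⟶ a') :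
    SliceCocone.IsHom ((hat ψ a).postcomp (U.map f)) ((hat l a).postcomp (L.map f ≫ g a'))
      (fun {b} u => eqToHom (show (laxApp ψ b ≫ U.map u) ≫ U.map f = laxApp ψ b ≫ U.map (u ≫ f) by
          rw [U.map_comp, Strict.assoc]) ≫ (R a').cell (u ≫ f) ≫
        eqToHom (show (laxApp l b ≫ L.map (u ≫ f)) ≫ g a' = (laxApp l b ≫ L.map u) ≫ L.map f ≫ g a'
          by simp only [L.map_comp, Strict.assoc])) := by
  intro b b' k u u' η
  have e := (R a').isHom k (η ▷ f ≫ (α_ (K.map k) u' f).hom)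
  refine CellEq.eq (CellEq.trans (.comp (hat_postcomp_map ψ f k η) (.whiskerLeft rfl
    ((CellEq.id_comp (.eqToHom _)).trans (.comp_id (.eqToHom _))))) ?_)
  exact (CellEq.of_eq e).trans (.comp
    ((CellEq.id_comp (.eqToHom _)).trans (.comp_id (.eqToHom _))).symm
    (hat_postcomp_comp_map l f (g a') k η).symm)

theorem exists_structure_cell (h : ∀ a c, IsIsoOfCategories (comparison S hl a c)) {a a' : A}
    (f : a ⟶ a') :
    ∃ γ : g a ≫ U.map f ⟶ L.map f ≫ g a', ∀ {b : B} (u : K.obj b ⟶ a),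
      (R a).cell u ▷ U.map f ≫ (α_ _ _ _).hom ≫ (laxApp l b ≫ L.map u) ◁ γ ≋
        (R a').cell (u ≫ f) := by
  obtain ⟨γ, hγ⟩ := ((R a).postcomp (U.map f)).exists_factor (h _ _) (isHom_cell_comp R f)
  refine ⟨γ, fun {b} u => ?_⟩
  refine (CellEq.of_eq ((Category.assoc _ _ _).symm.trans (hγ u))).trans ?_
  exact (CellEq.id_comp (.eqToHom _)).trans (.comp_id (.eqToHom _))

end extension

end

/-! ### Bijectivity of pasting on lax transformations -/

section
variable {B : Type u₁} [Bicategory.{w₁, v₁} B] [Strict B]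
  {A : Type u₂} [Bicategory.{w, v} A] [Strict A]
  {C : Type u} [Bicategory.{w, v} C] [Strict C]
  {K : StrictPseudofunctor B A} {F : StrictPseudofunctor B C} {L U : StrictPseudofunctor A C}
  {S : SplitDiscreteTwoOpfibration K} {l : Lax.LaxTrans F.toLax (K.comp L).toLax}
  {hl : IsCartesianMarkedLax S l}

theorem cellEq_ext (h : ∀ a c, IsIsoOfCategories (comparison S hl a c)) {a : A} {c : C}
    {g g' k k' : L.obj a ⟶ c} {γ : g ⟶ g'} {δ : k ⟶ k'} (hg : g = k) (hg' : g' = k')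
    (e : ∀ {b : B} (h : K.obj b = a), (laxApp l b ≫ L.map (eqToHom h)) ◁ γ ≋
      (laxApp l b ≫ L.map (eqToHom h)) ◁ δ) : γ ≋ δ := by
  subst hg hg'
  exact .of_eq (cell_ext h e)

section extension
variable {ψ : Lax.LaxTrans F.toLax (K.comp U).toLax} {g : ∀ a, L.obj a ⟶ U.obj a}
  (R : ∀ a, Representation l (hat ψ a) (g a))

/-- The defining property of the structure 2-cells of the extension of `ψ` along `l`. -/
def IsStructureCell {a a' : A} (f : a ⟶ a') (γ : g a ≫ U.map f ⟶ L.map f ≫ g a') : Prop :=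
  ∀ {b : B} (u : K.obj b ⟶ a),
    (R a).cell u ▷ U.map f ≫ (α_ _ _ _).hom ≫ (laxApp l b ≫ L.map u) ◁ γ ≋ (R a').cell (u ≫ f)

namespace IsStructureCell
variable {R}

/-- On the fibre the comparison cell of `R a` is an identity, so the restriction of `γ` is a
comparison cell of `R a'`. By `cellEq_ext`, these restrictions determine `γ`. -/
theorem whiskerLeft_fibre {a a' : A} {f : a ⟶ a'} {γ : g a ≫ U.map f ⟶ L.map f ≫ g a'}
    (hγ : IsStructureCell R f γ) {b : B} (e : K.obj b = a) :
    (laxApp l b ≫ L.map (eqToHom e)) ◁ γ ≋ (R a').cell (eqToHom e ≫ f) :=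
  CellEq.trans ((CellEq.id_comp (.id_whiskerRight ((R a).cell_eqToHom e) _)).trans
    (.id_comp (.associator_hom _ _ _))).symm (hγ (eqToHom e))

theorem id (h : ∀ a c, IsIsoOfCategories (comparison S hl a c)) {a : A}
    {γ : g a ≫ U.map (𝟙 a) ⟶ L.map (𝟙 a) ≫ g a} (hγ : IsStructureCell R (𝟙 a) γ) :
    γ ≋ 𝟙 (g a) := by
  refine cellEq_ext h (by rw [U.map_id, Strict.comp_id]) (by rw [L.map_id, Strict.id_comp])
    fun {b} e => ?_
  have hR := (R a).cell_eqToHom e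
  refine (hγ.whiskerLeft_fibre e).trans (((R a).cell_congr (Strict.comp_id _)).trans
    (hR.trans ((CellEq.id hR.cod.symm).trans ?_)))
  exact (CellEq.whiskerLeft_id _ (.refl _)).symm

theorem comp (h : ∀ a c, IsIsoOfCategories (comparison S hl a c)) {a a' a'' : A} {f : a ⟶ a'}
    {f' : a' ⟶ a''} {γ : g a ≫ U.map f ⟶ L.map f ≫ g a'}
    {γ' : g a' ≫ U.map f' ⟶ L.map f' ≫ g a''}
    {δ : g a ≫ U.map (f ≫ f') ⟶ L.map (f ≫ f') ≫ g a''} (hγ : IsStructureCell R f γ)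
    (hγ' : IsStructureCell R f' γ') (hδ : IsStructureCell R (f ≫ f') δ) :
    δ ≋ γ ▷ U.map f' ≫ (α_ _ _ _).hom ≫ L.map f ◁ γ' := by
  refine cellEq_ext h (by rw [U.map_comp, Strict.assoc]) (by rw [L.map_comp, Strict.assoc])
    fun {b} e => ?_
  -- The property of `γ'` is used at `eqToHom e ≫ f`, which is off the fibre; hence
  -- `IsStructureCell` quantifies over all `u`.
  refine (hδ.whiskerLeft_fibre e).trans (((R a'').cell_congr (Strict.assoc _ _ _).symm).trans
    ((hγ' (eqToHom e ≫ f)).symm.trans ?_))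
  simp only [Bicategory.whiskerLeft_comp]
  refine .comp ((CellEq.whiskerRight (hγ.whiskerLeft_fibre e) rfl).symm.trans
    (CellEq.whisker_assoc _ _ _)) ((CellEq.id_comp (.associator_hom _ _ _)).trans
      (CellEq.trans ?_ (CellEq.id_comp (.whiskerLeft_id _ (.associator_hom _ _ _))).symm))
  exact (CellEq.whiskerLeft (by rw [L.map_comp, Strict.assoc]) (.refl γ')).trans
    (CellEq.comp_whiskerLeft _ _ _)

theorem naturality (h : ∀ a c, IsIsoOfCategories (comparison S hl a c)) {a a' : A}
    {f f' : a ⟶ a'} {γ : g a ≫ U.map f ⟶ L.map f ≫ g a'}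
    {γ' : g a ≫ U.map f' ⟶ L.map f' ≫ g a'} (hγ : IsStructureCell R f γ)
    (hγ' : IsStructureCell R f' γ') (κ : f ⟶ f') :
    γ ≫ L.map₂ κ ▷ g a' = g a ◁ U.map₂ κ ≫ γ' := by
  refine cell_ext h fun {b} e => ?_
  simp only [Bicategory.whiskerLeft_comp]
  have hη : eqToHom e ◁ κ ≫ eqToHom (map_id_comp K (eqToHom e ≫ f')).symm ≋ eqToHom e ◁ κ :=
    .comp_id (.eqToHom _)
  -- Restricted to the fibre, naturality in `κ` is the compatibility of the cells of `R a'` with the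
  -- 2-cell `eqToHom e ◁ κ` over `𝟙 b`.
  have hR := CellEq.of_eq ((R a').isHom (𝟙 b) (eqToHom e ◁ κ ≫
    eqToHom (map_id_comp K (eqToHom e ≫ f')).symm))
  refine CellEq.trans (.comp (hγ.whiskerLeft_fibre e) ?_) (hR.symm.trans (.comp ?_
    ((CellEq.map_id_whiskerLeft F _).trans (hγ'.whiskerLeft_fibre e).symm)))
  · refine (CellEq.whisker_assoc _ _ _).symm.trans (CellEq.trans (.whiskerRight ?_ rfl)
      ((hat l a').postcomp_map _ _ _).symm)
    refine CellEq.trans ?_ (hat_map_id l hη).symm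
    exact (CellEq.comp_whiskerLeft _ _ _).trans (.whiskerLeft rfl (.symm (.map₂_whiskerLeft _ _ _)))
  · refine (hat_map_id ψ hη).trans ((CellEq.whiskerLeft rfl (.map₂_whiskerLeft _ _ _)).trans
      ((CellEq.comp_whiskerLeft _ _ _).symm.trans
        ((CellEq.whiskerLeft ?_ (.refl _)).trans (CellEq.comp_whiskerLeft _ _ _))))
    exact ((R a).cell_eqToHom e).cod.symm

end IsStructureCell

theorem exists_paste_eq (h : ∀ a c, IsIsoOfCategories (comparison S hl a c))
    (ψ : Lax.LaxTrans F.toLax (K.comp U).toLax) : ∃ φ, paste l φ = ψ := by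
  choose g R using fun a => Representation.exists_representation (h a (U.obj a)) (hat ψ a)
  replace R a := (R a).some
  choose φ hφ using fun (a a' : A) (f : a ⟶ a') => exists_structure_cell R h f
  replace hφ {a a' : A} (f : a ⟶ a') : IsStructureCell R f (φ a a' f) := hφ a a' f
  refine ⟨mkLax g (fun f => φ _ _ f) (fun κ => IsStructureCell.naturality h (hφ _) (hφ _) κ)
    (fun a => IsStructureCell.id h (hφ _))
    (fun f f' => IsStructureCell.comp h (hφ f) (hφ f') (hφ _)), laxTrans_ext ?_ ?_⟩
  · intro b
    -- The comparison cell at the identity of `K b` is an identity, so its endpoints `ψ b` and `l b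
    -- ≫ g (K b)` coincide.
    have e := ((R (K.obj b)).cell_eqToHom rfl).cod
    exact (congrArg (· ≫ g (K.obj b)) (laxApp_comp_map_eqToHom l b)).symm.trans
      (e.trans (laxApp_comp_map_eqToHom ψ b))
  · intro b b' f
    have hη : eqToHom (Strict.comp_id (K.map f)).symm ≋ 𝟙 (K.map f) := .eqToHom _
    -- The structure cells are compared through the morphism axiom at `f`, with the identity cell
    -- from `K f` to `K f ≫ 𝟙`.
    have e := CellEq.of_eq ((R (K.obj b')).isHom f (u' := eqToHom rfl)
      (eqToHom (Strict.comp_id (K.map f)).symm))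
    refine CellEq.trans (CellEq.of_eq (laxNat_paste (l := l) _ f)) ?_
    refine CellEq.trans (CellEq.id_comp (.associator_hom _ _ _)) ?_
    refine CellEq.trans (.comp (η' := (R (K.obj b')).cell (K.map f))
      (θ' := ((hat l (K.obj b')).postcomp (g (K.obj b'))).map f (eqToHom _)) ?_ ?_)
      (e.symm.trans ((CellEq.comp_id (.whiskerLeft_id _ ((R (K.obj b')).cell_eqToHom rfl))).trans
        (hat_map_of_eq_id ψ f hη)))
    · exact (CellEq.whiskerLeft (laxApp_comp_map_eqToHom l b).symm (.refl _)).trans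
        ((IsStructureCell.whiskerLeft_fibre (hφ (K.map f)) rfl).trans
          ((R _).cell_congr (Strict.id_comp _)))
    · refine CellEq.trans ((CellEq.id_comp (.associator_inv _ _ _)).trans
        (.comp_id (.associator_hom _ _ _))) ?_
      exact (CellEq.whiskerRight (hat_map_of_eq_id l f hη).symm rfl).trans
        ((hat l (K.obj b')).postcomp_map _ _ _).symm

end extension

theorem compApp_eq_of_paste_eq (h : ∀ a c, IsIsoOfCategories (comparison S hl a c))
    {φ φ' : Lax.LaxTrans L.toLax U.toLax} (e : paste l φ = paste l φ') (a : A) :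
    compApp φ a = compApp φ' a := by
  have R := representationOfLax l φ a
  rw [e] at R
  exact R.eq (h a _) (representationOfLax l φ' a)

theorem whiskerLeft_compNat_of_paste_eq (hl : IsCartesianMarkedLax S l)
    {φ φ' : Lax.LaxTrans L.toLax U.toLax} (e : paste l φ = paste l φ') {a : A} {b : B}
    (u : K.obj b ⟶ a) : laxApp l b ◁ compNat φ u ≋ laxApp l b ◁ compNat φ' u := by
  -- The pastings are generalized to variables so that their equality can be eliminated.
  have H : ∀ {ψ ψ' : Lax.LaxTrans F.toLax (K.comp U).toLax}, ψ = ψ' → ∀ {g g' : L.obj a ⟶ U.obj a}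
      (R : Representation l (hat ψ a) g) (R' : Representation l (hat ψ' a) g'),
      R.cell u ≋ R'.cell u := by
    rintro ψ _ rfl g g' R R'
    exact R.cell_unique hl R' u
  exact (representationOfLax_cell φ u).symm.trans ((H e _ _).trans (representationOfLax_cell φ' u))

/-- Components are representing 1-cells of the same cocone. A structure cell at `f : K b ⟶ a'`,
restricted along `l b`, is a comparison cell at `u = f`, and those are unique too. -/
theorem paste_injective (h : ∀ a c, IsIsoOfCategories (comparison S hl a c)) :
    Function.Injective (paste (U := U) l) := by
  intro φ φ' e
  have e' := compApp_eq_of_paste_eq h e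
  refine laxTrans_ext e' (fun {a a'} f => ?_)
  refine cellEq_ext h (congrArg (· ≫ U.map f) (e' a)) (congrArg (L.map f ≫ ·) (e' a'))
    fun {b} hb => ?_
  subst hb
  refine (CellEq.whiskerLeft (laxApp_comp_map_eqToHom l b) (.refl _)).trans ?_
  exact (whiskerLeft_compNat_of_paste_eq hl e f).trans
    (CellEq.whiskerLeft (laxApp_comp_map_eqToHom l b).symm (.refl _))

/-! ### Full faithfulness of pasting on modifications -/

section modification
open scoped Lax.LaxTrans

variable {φ φ' : L.toLax ⟶ U.toLax}

theorem pasting_faithful (h : ∀ a c, IsIsoOfCategories (comparison S hl a c)) :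
    (pasting l U).Faithful where
  map_injective {φ φ' Γ Γ'} e := by
    ext a
    refine cell_ext h fun {b} hb => ?_
    subst hb
    have e' : laxApp l b ◁ Γ.as.app (K.obj b) = laxApp l b ◁ Γ'.as.app (K.obj b) :=
      congrArg (fun m => m.as.app b) e
    exact (CellEq.whiskerLeft (laxApp_comp_map_eqToHom l b) (.refl _)).trans
      ((CellEq.of_eq e').trans (CellEq.whiskerLeft (laxApp_comp_map_eqToHom l b).symm (.refl _)))

theorem isHom_whiskerRight_aux {x x' p q y : C} {k : x ⟶ x'} {i j : x ⟶ p} {i' j' : x' ⟶ q}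
    {m : p ⟶ q} (d : i ⟶ j) (d' : i' ⟶ j') {v : p ⟶ y} {u : q ⟶ y} (M : v ⟶ m ≫ u)
    (N : i ≫ m ⟶ k ≫ i') (N' : j ≫ m ⟶ k ≫ j') (h : d ▷ m ≫ N' = N ≫ k ◁ d') :
    (i ◁ M ≫ (α_ _ _ _).inv ≫ N ▷ u ≫ (α_ _ _ _).hom) ≫ k ◁ d' ▷ u =
      d ▷ v ≫ j ◁ M ≫ (α_ _ _ _).inv ≫ N' ▷ u ≫ (α_ _ _ _).hom := by
  have e := congrArg (· ▷ u) h
  simp only [comp_whiskerRight, whisker_assoc] at e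
  have e' := e =≫ (α_ k j' u).hom
  simp only [Category.assoc, Iso.inv_hom_id, Category.comp_id] at e'
  rw [← reassoc_of% whisker_exchange]
  simp [e']

theorem isHom_whiskerRight (Θ : (pasting l U).obj φ ⟶ (pasting l U).obj φ') (a : A) :
    SliceCocone.IsHom (hat (paste l φ) a) (hat (paste l φ') a)
      (fun {b} u => (Θ.as.app b : laxApp (paste l φ) b ⟶ laxApp (paste l φ') b) ▷ U.map u) :=
  fun {b b'} f {_ u'} η => isHom_whiskerRight_aux (Θ.as.app b) (Θ.as.app b')
    (U.map₂ η ≫ (U.mapComp (K.map f) u').hom) (laxNat (paste l φ) f) (laxNat (paste l φ') f)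
    (Θ.as.naturality f)

/-- A modification `Θ` induces a morphism between the two slice cocones. Composed with the
comparison cells of `φ'`, it factors through the cocone represented by `φ`. -/
theorem exists_whiskerLeft_compNat (h : ∀ a c, IsIsoOfCategories (comparison S hl a c))
    (Θ : (pasting l U).obj φ ⟶ (pasting l U).obj φ') (a : A) :
    ∃ γ : compApp φ a ⟶ compApp φ' a, ∀ {b : B} (u : K.obj b ⟶ a),
      laxApp l b ◁ compNat φ u ≫ laxApp l b ◁ L.map u ◁ γ ≋
        (Θ.as.app b : laxApp (paste l φ) b ⟶ laxApp (paste l φ') b) ▷ U.map u ≫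
          (α_ (laxApp l b) (compApp φ' (K.obj b)) (U.map u)).hom ≫ laxApp l b ◁ compNat φ' u := by
  obtain ⟨γ, hγ⟩ := (representationOfLax l φ a).exists_factor (h _ _)
    (σ := fun {b} u => (Θ.as.app b : laxApp (paste l φ) b ⟶ laxApp (paste l φ') b) ▷ U.map u ≫
      (representationOfLax l φ' a).cell u)
    (fun {_ _} => SliceCocone.IsHom.comp (V := hat (paste l φ) a) (W := hat (paste l φ') a)
      (X := (hat l a).postcomp (compApp φ' a))
      (τ := fun {b} u => (Θ.as.app b : laxApp (paste l φ) b ⟶ laxApp (paste l φ') b) ▷ U.map u)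
      (isHom_whiskerRight Θ a) (σ := (representationOfLax l φ' a).cell)
      (representationOfLax l φ' a).isHom)
  refine ⟨γ, fun {b} u => ?_⟩
  refine (CellEq.comp (representationOfLax_cell φ u).symm
    (CellEq.comp_whiskerLeft _ _ _).symm).trans ((CellEq.of_eq (hγ u)).trans ?_)
  exact .comp (.refl _) (.comp (.refl _) (.comp_id (.associator_inv _ _ _)))

theorem pasting_full (h : ∀ a c, IsIsoOfCategories (comparison S hl a c)) :
    (pasting l U).Full where
  map_surjective {φ φ'} Θ := by
    -- One equation serves twice: at an identity `u` it says that `γ` restricts to `Θ`, and at `u =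
    -- f` it is the modification axiom restricted along `l b`.
    choose γ hγ using exists_whiskerLeft_compNat h Θ
    have fibre (b : B) : laxApp l b ◁ γ (K.obj b) ≋ Θ.as.app b := by
      have e := hγ (K.obj b) (eqToHom rfl)
      refine CellEq.trans (CellEq.trans ?_ (CellEq.id_comp (.whiskerLeft_id _
        ((compNat_eqToHom φ rfl).trans (.id (compNat_eqToHom φ rfl).dom.symm)))).symm)
        (e.trans ((CellEq.comp_id (.comp_eq_id (.associator_hom _ _ _)
          (.whiskerLeft_id _ (compNat_eqToHom φ' rfl)))).trans ?_))
      · refine .whiskerLeft rfl ((CellEq.id_whiskerLeft _).symm.trans (.whiskerLeft ?_ (.refl _)))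
        exact (L.map_id _).symm
      · exact (CellEq.whiskerRight (.refl _) (U.map_id _)).trans (.whiskerRight_id _)
    refine ⟨⟨⟨γ, fun {a a'} f => cell_ext h fun {b} hb => ?_⟩⟩, ?_⟩
    · subst hb
      refine (CellEq.whiskerLeft (laxApp_comp_map_eqToHom l b) (.refl _)).trans (CellEq.trans ?_
        (CellEq.whiskerLeft (laxApp_comp_map_eqToHom l b).symm (.refl _)))
      refine CellEq.trans (CellEq.of_eq (Bicategory.whiskerLeft_comp (laxApp l b)
        (γ (K.obj b) ▷ U.map f) (compNat φ' f))) (CellEq.trans ?_ (CellEq.of_eq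
          (Bicategory.whiskerLeft_comp (laxApp l b) (compNat φ f) (L.map f ◁ γ a'))).symm)
      refine CellEq.trans (.comp ((CellEq.whisker_assoc _ _ _).symm.trans
        (.whiskerRight (fibre b) rfl)) ?_) (hγ a' f).symm
      exact (CellEq.id_comp (.associator_hom _ _ _)).symm
    · ext b
      exact (fibre b).eq

/-- Pointwise left Kan extensions along split discrete 2-opfibrations are weak. -/
theorem IsPointwiseLeftKanExtension.isWeakLeftKanExtension
    (h : IsPointwiseLeftKanExtension S F L l) : IsWeakLeftKanExtension F L l := by
  obtain ⟨hl, h⟩ := h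
  intro U
  have := pasting_full (U := U) h
  have := pasting_faithful (U := U) h
  exact isIsoOfCategories_of_bijective ⟨paste_injective h, exists_paste_eq h⟩

end modification

end

end TwoCat

theorem mainTheorem5
    {B : Type u₁} [Bicategory.{w₁, v₁} B] [Bicategory.Strict B]
    {A : Type u₂} [Bicategory.{w, v} A] [Bicategory.Strict A]
    {C : Type u₃} [Bicategory.{w, v} C] [Bicategory.Strict C]
    (K : StrictPseudofunctor B A) (S : TwoCat.SplitDiscreteTwoOpfibration K)
    (F : StrictPseudofunctor B C) (L : StrictPseudofunctor A C)
    (l : Lax.LaxTrans F.toLax (K.comp L).toLax)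
    (h : TwoCat.IsPointwiseLeftKanExtension S F L l) :
    TwoCat.IsWeakLeftKanExtension F L l :=
  h.isWeakLeftKanExtension
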